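/- Let $0=a_0<a_1<\cdots<a_r<a_{r+1}=n$ be integers, let $e_1,\dots,e_n$ be the standard basis of $\mathbb{C}^n$, and put $E_k=\langle e_1,\dots,e_k\rangle$, $E_\bullet=(E_1\subset\cdots\subset E_n)$, $A_i=\{a_{i-1}+1,\dots,a_i\}$, $b_i=a_i-a_{i-1}$ and $Q_i=\langle e_t : t\in A_i\rangle$ for $1\le i\le r+1$, so that $\mathbb{C}^n=Q_1\oplus\cdots\oplus Q_{r+1}$. Let $\mathrm{F\ell}(a,n)$ be the variety of partial flags $V_1\subset\cdots\subset V_r\subset\mathbb{C}^n$ with $\dim V_k=a_k$, and $\tilde E_\bullet=(E_{a_1}\subset\cdots\subset E_{a_r})$. Let $L\subset SL_n(\mathbb{C})$ be the subgroup of block diagonal matrices of determinant $1$ (those preserving every $Q_i$), and let $S_n(a)$ be the set of $w\in S_n$ with $w(i)<w(i+1)$ for all $1\le i<n$ with $i\notin\{a_1,\dots,a_r\}$. For a complete flag $F_\bullet$ of $\mathbb{C}^n$ and $w\in S_n(a)$ the Schubert cell is $$X_w^\circ(F_\bullet)=\{V_\bullet\in \mathrm{F\ell}(a,n) : \dim(V_k\cap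 F_j)=\#\{t\le a_k : w(t)\le j\}\ \text{for all } k,j\},$$ and Schubert cells in Grassmannians (partial flags with one step) of any finite-dimensional complex vector space with a complete flag are defined in the same way. For $i<j$ let $w_{i,j}\in S_{b_i+b_j}$ be the flattening of the sequence $(w(t))_{t\in A_i\cup A_j}$, that is, the permutation whose values are in the same relative order as that sequence. Let $\mathrm{F\ell}_{L,w}(n)$ be the set of complete flags of the form $l w^{-1}E_\bullet$ with $l\in L$, where $w^{-1}$ acts by $e_k\mapsto e_{w^{-1}(k)}$. For a complete flag $F_\bullet$ of $\mathbb{C}^n$ and a subspace $W$, let $F_\bullet(W)$ be the complete flag of $W$ formed by the subspaces $F_k\cap W$. Regard tangent spaces of subvarieties of $\mathrm{F\ell}(a,n)$ at $V_\bullet$ as subspaces of $\bigoplus_{k=1}^r\mathrm{Hom}(V_k,\mathbb{C}^n/V_k)$. Then $$T_{\tilde E_\bullet}\mathrm{F\ell}(a,n)=\bigoplus_{1\le i<j\le r+1}\mathrm{Hom}(Q_i,Q_j),$$ where $\psi\in \mathrm{Hom}(Q_i,Q_j)$ is identified with the tangent vector obtained by extending $\psi$ by zero to the other summands $Q_m$,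 restricting to each $E_{a_k}$ and reducing modulo $E_{a_k}$. Moreover $T_{Q_i}\mathrm{Gr}(b_i,Q_i\oplus Q_j)=\mathrm{Hom}(Q_i,(Q_i\oplus Q_j)/Q_i)\simeq\mathrm{Hom}(Q_i,Q_j)$ for $i<j$. Proposition. Let $w\in S_n(a)$ and $F_\bullet\in\mathrm{F\ell}_{L,w}(n)$. Then $\tilde E_\bullet\in X_w^\circ(F_\bullet)$ and, for all $i<j$, $w_{i,j}\in S_{b_i+b_j}(\{b_i\})$ and $Q_i\in X^\circ_{w_{i,j}}(F_\bullet(Q_i\oplus Q_j))\subseteq \mathrm{Gr}(b_i,Q_i\oplus Q_j)$. With the identifications above, the following hold: (i) $\displaystyle T_{\tilde E_\bullet}X_w^\circ(F_\bullet)=\bigoplus_{1\le i<j\le r+1}\big(\mathrm{Hom}(Q_i,Q_j)\cap T_{\tilde E_\bullet}X_w^\circ(F_\bullet)\big)$; (ii) for all $1\le i<j\le r+1$, $\displaystyle \mathrm{Hom}(Q_i,Q_j)\cap T_{\tilde E_\bullet}X_w^\circ(F_\bullet)=T_{Q_i}X^\circ_{w_{i,j}}\big(F_\bullet(Q_i\oplus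 Q_j)\big)$. -/

import Mathlib

noncomputable section

namespace SchubertTangent

/-! ### Zariski tangent spaces -/

section Zariski

variable {M : Type*} [AddCommGroup M] [Module ℂ M]

/-- Value at the point `x` of the polynomial function `p` on the complex vector space `M`.
Polynomial functions on `M` are written as polynomials in the linear functionals on `M`. -/
def polyEval (p : MvPolynomial (Module.Dual ℂ M) ℂ) (x : M) : ℂ :=
  MvPolynomial.eval (fun ξ : Module.Dual ℂ M => ξ x) p

/-- The polynomial function `∑_ξ ξ(v) ∂p/∂ξ`, the derivative of `p` in the direction `v`. -/
def polyDeriv (v : M) (p : MvPolynomial (Module.Dual ℂ M) ℂ) :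
    MvPolynomial (Module.Dual ℂ M) ℂ :=
  MvPolynomial.mkDerivation ℂ (fun ξ : Module.Dual ℂ M => MvPolynomial.C (ξ v)) p

theorem polyDeriv_add (v v' : M) (p : MvPolynomial (Module.Dual ℂ M) ℂ) :
    polyDeriv (v + v') p = polyDeriv v p + polyDeriv v' p := by
  have h : MvPolynomial.mkDerivation ℂ
        (fun ξ : Module.Dual ℂ M => (MvPolynomial.C (ξ (v + v')) :
          MvPolynomial (Module.Dual ℂ M) ℂ))
      = MvPolynomial.mkDerivation ℂ (fun ξ : Module.Dual ℂ M => MvPolynomial.C (ξ v))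
        + MvPolynomial.mkDerivation ℂ (fun ξ : Module.Dual ℂ M => MvPolynomial.C (ξ v')) := by
    apply MvPolynomial.derivation_ext
    intro ξ
    simp [MvPolynomial.mkDerivation_X]
  exact congrArg (fun D => D p) h

theorem polyDeriv_smul (c : ℂ) (v : M) (p : MvPolynomial (Module.Dual ℂ M) ℂ) :
    polyDeriv (c • v) p = c • polyDeriv v p := by
  have h : MvPolynomial.mkDerivation ℂ
        (fun ξ : Module.Dual ℂ M => (MvPolynomial.C (ξ (c • v)) :
          MvPolynomial (Module.Dual ℂ M) ℂ))
      = c • MvPolynomial.mkDerivation ℂ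
          (fun ξ : Module.Dual ℂ M => MvPolynomial.C (ξ v)) := by
    apply MvPolynomial.derivation_ext
    intro ξ
    simp [MvPolynomial.mkDerivation_X, MvPolynomial.smul_eq_C_mul]
  exact congrArg (fun D => D p) h

/-- The Zariski tangent space at `x` of a locally closed subset `Y ∋ x` of the vector space `M`:
the vectors killed by the differentials at `x` of all polynomial functions vanishing on `Y`. -/
def zariskiTangent (Y : Set M) (x : M) : Submodule ℂ M where
  carrier := {v | ∀ p : MvPolynomial (Module.Dual ℂ M) ℂ,
    (∀ y ∈ Y, polyEval p y = 0) → polyEval (polyDeriv v p) x = 0}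
  zero_mem' := by
    intro p _
    have h : polyDeriv (0 : M) p = 0 := by
      simpa using polyDeriv_smul (0 : ℂ) (0 : M) p
    simp [h, polyEval]
  add_mem' := by
    intro v v' hv hv' p hp
    have h1 := hv p hp
    have h2 := hv' p hp
    simp only [polyEval] at h1 h2 ⊢
    rw [polyDeriv_add, map_add, h1, h2, add_zero]
  smul_mem' := by
    intro c v hv p hp
    have h1 := hv p hp
    simp only [polyEval] at h1 ⊢
    rw [polyDeriv_smul, MvPolynomial.smul_eval, h1, mul_zero]

end Zariski

/-! ### Partial flags and the tangent spaces of their subvarieties -/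

section Flags

variable {E : Type*} [AddCommGroup E] [Module ℂ E] {ι : Type*}

/-- The partial flag variety `{V | V_k ⊆ V_l for k ≤ l, dim V_k = d k}`. If `ι` is a point this is
the Grassmannian of `d`-dimensional subspaces. -/
def flagVariety [Preorder ι] (E : Type*) [AddCommGroup E] [Module ℂ E] (d : ι → ℕ) :
    Set (ι → Submodule ℂ E) :=
  {V | Monotone V ∧ ∀ k, Module.finrank ℂ (V k) = d k}

/-- The Schubert cell of `w` with respect to the complete flag `F` (a maximal chain of subspaces).
Positions and values of `w` are counted from `0`, so the dimension of `V_k ∩ F_j` has to be the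
number of `t < d k` with `w t < j`, for the member `U = F_j` of the flag of dimension `j`. -/
def schubertCell [Preorder ι] {m : ℕ} (d : ι → ℕ) (w : Equiv.Perm (Fin m))
    (F : Flag (Submodule ℂ E)) : Set (ι → Submodule ℂ E) :=
  {V | V ∈ flagVariety E d ∧ ∀ k, ∀ U ∈ F, Module.finrank ℂ (V k ⊓ U : Submodule ℂ E) =
    (Finset.univ.filter fun t : Fin m =>
      t.val < d k ∧ (w t).val < Module.finrank ℂ U).card}

/-- The differential at `1` of the orbit map `g ↦ g V` from `GL(E)` to partial flags:
`x ∈ End(E) = T_1 GL(E)` goes to the family of maps `V_k → E / V_k`, `v ↦ x v mod V_k`. -/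
def orbitDifferential (V : ι → Submodule ℂ E) :
    Module.End ℂ E →ₗ[ℂ] (∀ k, V k →ₗ[ℂ] E ⧸ V k) where
  toFun x := fun k => (V k).mkQ ∘ₗ x ∘ₗ (V k).subtype
  map_add' x y := by
    funext k; ext v; simp
  map_smul' c x := by
    funext k; ext v; simp

/-- The tangent space at `V` of a (locally closed) subvariety `X ∋ V` of a partial flag variety, as
a subspace of `∏_k T_{V_k} Gr = ∏_k Hom(V_k, E / V_k)`. The flag variety is a quotient of `GL(E)`, so
the tangent space of `X` is the image of the Zariski tangent space at `1` of the preimage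
`{g ∈ GL(E) | g V ∈ X}` of `X` under the orbit map `g ↦ g V`. -/
def tangentSpace (X : Set (ι → Submodule ℂ E)) (V : ι → Submodule ℂ E) :
    Submodule ℂ (∀ k, V k →ₗ[ℂ] E ⧸ V k) :=
  (zariskiTangent {g : Module.End ℂ E | IsUnit g ∧ (fun k => (V k).map g) ∈ X} 1).map
    (orbitDifferential V)

/-- The complete flag `{U ∩ W | U ∈ F}` induced by a complete flag `F` on a subspace `W`. -/
def inducedFlag (F : Flag (Submodule ℂ E)) (W : Submodule ℂ E) : Flag (Submodule ℂ W) where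
  carrier := (fun U => U.comap W.subtype) '' (F : Set (Submodule ℂ E))
  Chain' := by
    rintro _ ⟨U, hU, rfl⟩ _ ⟨U', hU', rfl⟩ _
    rcases F.le_or_le hU hU' with h | h
    · exact Or.inl (Submodule.comap_mono h)
    · exact Or.inr (Submodule.comap_mono h)
  max_chain' := by
    intro s hs hsub
    refine Set.Subset.antisymm hsub fun X hX => ?_
    have hcmp : ∀ U ∈ F, U.comap W.subtype ≤ X ∨ X ≤ U.comap W.subtype := fun U hU =>
      hs.total (hsub ⟨U, hU, rfl⟩) hX
    set S : Set (Submodule ℂ E) := {U | U ∈ F ∧ U.comap W.subtype ≤ X} with hS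
    have hSne : S.Nonempty := by
      refine ⟨⊥, F.bot_mem, ?_⟩
      intro x hx
      have hx0 : x = 0 := by simpa using hx
      rw [hx0]; exact X.zero_mem
    have hSdir : DirectedOn (· ≤ ·) S := by
      intro U hU U' hU'
      rcases F.le_or_le hU.1 hU'.1 with h | h
      · exact ⟨U', hU', h, le_rfl⟩
      · exact ⟨U, hU, le_rfl, h⟩
    have hA : ∀ x : W, (x : E) ∈ sSup S → x ∈ X := by
      intro x hx
      obtain ⟨U, hU, hxU⟩ := (Submodule.mem_sSup_of_directed hSne hSdir).1 hx
      exact hU.2 hxU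
    set Z : Submodule ℂ E := sSup S ⊔ X.map W.subtype with hZ
    have hZF : Z ∈ F := by
      have hch : IsChain (· ≤ ·) (insert Z (F : Set (Submodule ℂ E))) := by
        refine F.chain_le.insert fun U hU _ => ?_
        by_cases hUX : U.comap W.subtype ≤ X
        · exact Or.inr ((le_sSup (show U ∈ S from ⟨hU, hUX⟩)).trans le_sup_left)
        · left
          refine sup_le (sSup_le fun U' hU' => ?_) ?_
          · rcases F.le_or_le hU'.1 hU with h | h
            · exact h
            · exact absurd ((Submodule.comap_mono h).trans hU'.2) hUX
          · exact Submodule.map_le_iff_le_comap.2 ((hcmp U hU).resolve_left hUX)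
      have heq := F.max_chain' hch (Set.subset_insert _ _)
      have hmem : Z ∈ insert Z (F : Set (Submodule ℂ E)) := Set.mem_insert _ _
      rw [← heq] at hmem
      exact hmem
    refine ⟨Z, hZF, le_antisymm ?_ ?_⟩
    · intro x hx
      obtain ⟨y, hy, z, hz, hyz⟩ := Submodule.mem_sup.1 (show (x : E) ∈ Z from hx)
      obtain ⟨z', hz', rfl⟩ := hz
      have hyx : ((x - z' : W) : E) ∈ sSup S := by
        have : ((x - z' : W) : E) = y := by
          simp [← hyz]
        rw [this]; exact hy
      have := X.add_mem (hA _ hyx) hz'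
      simpa using this
    · intro x hx
      exact Submodule.mem_sup_right ⟨x, hx, rfl⟩

/-- The image `g F` of a complete flag under a linear automorphism. -/
def flagMap (g : E ≃ₗ[ℂ] E) (F : Flag (Submodule ℂ E)) : Flag (Submodule ℂ E) :=
  Flag.map (Submodule.orderIsoMapComap g) F

end Flags

/-! ### Permutations -/

/-- The flattening of `w` along `A = {α_0 < ... < α_{c-1}}`: the unique permutation of
`{0, ..., c-1}` whose values are in the same relative order as `w α_0, ..., w α_{c-1}`. -/
def flatten {n : ℕ} (w : Equiv.Perm (Fin n)) (A : Finset (Fin n)) : Equiv.Perm (Fin A.card) :=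
  ((A.orderIsoOfFin rfl).toEquiv.trans
    (w.subtypeEquiv (q := fun k => k ∈ A.map w.toEmbedding) fun k => by simp)).trans
    ((A.map w.toEmbedding).orderIsoOfFin (A.card_map w.toEmbedding)).symm.toEquiv

theorem flatten_lt_iff {n : ℕ} (w : Equiv.Perm (Fin n)) (A : Finset (Fin n)) (s t : Fin A.card) :
    flatten w A s < flatten w A t ↔
      w (A.orderEmbOfFin rfl s) < w (A.orderEmbOfFin rfl t) := by
  simp [flatten, Equiv.subtypeEquiv]

/-- The permutations without descents except at the positions `d k`: for the sequence `d` of the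
dimensions `a_1 < ... < a_r` this is the set `S_n(a)`. (The positions `i, i + 1` counted from `1` are
`p = i - 1` and `q = i` counted from `0`.) -/
def IsMinimalRep {n : ℕ} {ι : Type*} (d : ι → ℕ) (w : Equiv.Perm (Fin n)) : Prop :=
  ∀ p q : Fin n, q.val = p.val + 1 → (∀ k, q.val ≠ d k) → w p < w q

/-! ### The standard flag of `ℂⁿ` and the Levi subgroup

The type of the flag variety is a sequence `0 = a 0 < a 1 < ... < a r < a (r + 1) = n`. Basis vectors
of `ℂⁿ` are numbered from `0` to `n - 1`. -/

section Standard

variable {n r : ℕ}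

/-- The span of the standard basis vectors `e_k`, `k ∈ A`. -/
def coordSpan (A : Finset (Fin n)) : Submodule ℂ (Fin n → ℂ) :=
  Submodule.span ℂ ((fun k => (Pi.single k 1 : Fin n → ℂ)) '' (A : Set (Fin n)))

/-- The coordinate projection of `ℂⁿ` onto the span of the `e_k`, `k ∈ A`. -/
def coordProj (A : Finset (Fin n)) : (Fin n → ℂ) →ₗ[ℂ] coordSpan A :=
  LinearMap.codRestrict (coordSpan A)
    (∑ k ∈ A, (LinearMap.single ℂ (fun _ : Fin n => ℂ) k) ∘ₗ LinearMap.proj k) (by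
      intro v
      rw [LinearMap.sum_apply]
      refine Submodule.sum_mem _ fun k hk => ?_
      have h : (LinearMap.single ℂ (fun _ : Fin n => ℂ) k ∘ₗ LinearMap.proj k) v
          = v k • (Pi.single k 1 : Fin n → ℂ) := by
        ext l
        by_cases hl : l = k
        · subst hl; simp
        · simp [hl]
      rw [h]
      exact Submodule.smul_mem _ _ (Submodule.subset_span ⟨k, hk, rfl⟩))

/-- The `i`-th block of indices `a i, ..., a (i + 1) - 1`. -/
def block (n : ℕ) (a : Fin (r + 2) → ℕ) (i : Fin (r + 1)) : Finset (Fin n) :=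
  Finset.univ.filter fun k => a i.castSucc ≤ k.val ∧ k.val < a i.succ

/-- The block sizes `b_i`. -/
def blockSize (a : Fin (r + 2) → ℕ) (i : Fin (r + 1)) : ℕ := a i.succ - a i.castSucc

/-- The summand `Q_i` of `ℂⁿ`. -/
abbrev Q (n : ℕ) (a : Fin (r + 2) → ℕ) (i : Fin (r + 1)) : Submodule ℂ (Fin n → ℂ) :=
  coordSpan (block n a i)

/-- The dimensions `a 1, ..., a r` of the proper steps of the partial flags. -/
def steps (a : Fin (r + 2) → ℕ) (k : Fin r) : ℕ := a k.succ.castSucc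

/-- The standard partial flag `E_{a 1} ⊆ ... ⊆ E_{a r}`. -/
def stdPartialFlag (n : ℕ) (a : Fin (r + 2) → ℕ) : Fin r → Submodule ℂ (Fin n → ℂ) :=
  fun k => coordSpan (Finset.univ.filter fun t : Fin n => t.val < steps a k)

/-- The standard complete flag `E_1 ⊆ ... ⊆ E_n`. -/
def stdFlag (n : ℕ) : Flag (Submodule ℂ (Fin n → ℂ)) := (Pi.basisFun ℂ (Fin n)).toFlag

/-- The action of a permutation on `ℂⁿ` by `e_k ↦ e_{w k}`. -/
def permAct (w : Equiv.Perm (Fin n)) : (Fin n → ℂ) ≃ₗ[ℂ] (Fin n → ℂ) :=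
  LinearEquiv.funCongrLeft ℂ ℂ w.symm

theorem permAct_single (w : Equiv.Perm (Fin n)) (k : Fin n) :
    permAct w (Pi.single k 1) = Pi.single (w k) 1 := by
  ext l
  simp [permAct, LinearEquiv.funCongrLeft_apply, LinearMap.funLeft_apply, Pi.single_apply,
    Equiv.symm_apply_eq]

/-- The Levi subgroup `L` of `SL_n`: the block diagonal matrices of determinant one. -/
def levi (n : ℕ) (a : Fin (r + 2) → ℕ) : Set (Matrix.SpecialLinearGroup (Fin n) ℂ) :=
  {g | ∀ p q : Fin n, (¬ ∃ i, p ∈ block n a i ∧ q ∈ block n a i) → g.1 p q = 0}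

/-- The set `Fl_{L,w}(n)` of complete flags `l w⁻¹ E` with `l ∈ L`. -/
def leviFlags (a : Fin (r + 2) → ℕ) (w : Equiv.Perm (Fin n)) :
    Set (Flag (Submodule ℂ (Fin n → ℂ))) :=
  {F | ∃ l ∈ levi n a,
    F = flagMap (Matrix.SpecialLinearGroup.toLin' l) (flagMap (permAct w⁻¹) (stdFlag n))}

/-- The map `Hom(Q_i, Q_j) → ∏_k Hom(E_{a k}, ℂⁿ / E_{a k})` of the block decomposition of the tangent
space at the standard partial flag: extend `ψ : Q_i → Q_j` by zero on the other summands of `ℂⁿ`, then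
restrict to `E_{a k}` and reduce modulo `E_{a k}`. -/
def homToTangent (n : ℕ) (a : Fin (r + 2) → ℕ) (i j : Fin (r + 1)) :
    (Q n a i →ₗ[ℂ] Q n a j) →ₗ[ℂ]
      (∀ k, stdPartialFlag n a k →ₗ[ℂ] (Fin n → ℂ) ⧸ stdPartialFlag n a k) :=
  orbitDifferential (stdPartialFlag n a) ∘ₗ
    (LinearMap.lcomp ℂ (Fin n → ℂ) (coordProj (block n a i))) ∘ₗ
    (LinearMap.compRight ℂ (Q n a j).subtype)

/-- The summand `Hom(Q_i, Q_j)` of the tangent space at the standard partial flag. -/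
def homSummand (n : ℕ) (a : Fin (r + 2) → ℕ) (i j : Fin (r + 1)) :
    Submodule ℂ (∀ k, stdPartialFlag n a k →ₗ[ℂ] (Fin n → ℂ) ⧸ stdPartialFlag n a k) :=
  LinearMap.range (homToTangent n a i j)

end Standard

/-! ### The point `P` of the Grassmannian of `P ⊕ P'` -/

section Grassmannian

variable {E : Type*} [AddCommGroup E] [Module ℂ E]

/-- `P` as a subspace of `P + P'`, regarded as a point of a Grassmannian, that is, as a flag with a
single step. -/
def grPoint (P P' : Submodule ℂ E) : Unit → Submodule ℂ ↥(P ⊔ P') :=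
  fun _ => P.comap (P ⊔ P').subtype

/-- The point `grPoint P P'` is a copy of `P`. -/
def grPointEquiv (P P' : Submodule ℂ E) (k : Unit) : grPoint P P' k ≃ₗ[ℂ] P :=
  Submodule.comapSubtypeEquivOfLe (le_sup_left : P ≤ P ⊔ P')

/-- The map `Hom(P, P') → Hom(P, (P + P') / P)`, `ψ ↦ (v ↦ ψ v mod P)`. -/
def homToGrTangent (P P' : Submodule ℂ E) :
    (P →ₗ[ℂ] P') →ₗ[ℂ] (∀ k, grPoint P P' k →ₗ[ℂ] ↥(P ⊔ P') ⧸ grPoint P P' k) where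
  toFun ψ := fun k => (grPoint P P' k).mkQ ∘ₗ Submodule.inclusion le_sup_right ∘ₗ ψ ∘ₗ
    (grPointEquiv P P' k).toLinearMap
  map_add' x y := by
    simp only [LinearMap.add_comp, LinearMap.comp_add]
    rfl
  map_smul' c x := by
    simp only [LinearMap.smul_comp, LinearMap.comp_smul]
    rfl

end Grassmannian

end SchubertTangent

end

/-! A Schubert cell is cut out by the dimensions of `V_k ∩ U`, with `U` in the flag. Linearising
these conditions along `g ↦ g V` suggests that the tangent space at `V` is the image of
`rankTangent`, the endomorphisms `x` with `x (V_k ∩ U) ⊆ V_k + U`. This is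
`tangentSpace_schubertCell`, proved when one basis is adapted to every `V_k` and every `U`. For the
upper bound, bordered minors vanish on the cell, and their differentials at `1` are exactly the
matrix entries that must vanish. For the lower bound, `x` is split into elementary matrices: each
one that occurs either fixes every `V_k`, hence is zero in the tangent space, or stabilises the
flag, so that almost all of the line `1 + c e` moves `V` inside the cell.

For a flag `l w⁻¹ E` with `l` block diagonal, the columns `f_t` of `l` form such a basis
(`exists_basis_of_mem_leviFlags`), and each `f_t` lies in a single `Q_i`. Hence all `V_k` and `U`
are stable under the projections to the `Q_i` (`IsCoord.coordProj_mem`), and `rankTangent` contains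
every block of each of its elements. This gives (i). For (ii), the extensions by zero of `ψ : Q_i →
Q_j` to `ℂⁿ` and to `Q_i ⊕ Q_j` lie in the respective `rankTangent` under the same condition: `ψ
(Q_i ∩ U) ⊆ U` for all `U` in the flag. -/

noncomputable section

namespace SchubertTangent

open Module

/-! ### Derivatives along lines -/

section Line

variable {M : Type*} [AddCommGroup M] [Module ℂ M]

/-- The restriction of the polynomial function `p` to the line `t ↦ x + t v`. -/
def linePoly (x v : M) (p : MvPolynomial (Module.Dual ℂ M) ℂ) : Polynomial ℂ :=
  MvPolynomial.aeval (fun ξ : Module.Dual ℂ M =>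
    (Polynomial.C (ξ x) + Polynomial.X * Polynomial.C (ξ v) : Polynomial ℂ)) p

theorem eval_linePoly (x v : M) (p : MvPolynomial (Module.Dual ℂ M) ℂ) (t : ℂ) :
    (linePoly x v p).eval t = polyEval p (x + t • v) := by
  induction p using MvPolynomial.induction_on with
  | C c => simp [linePoly, polyEval]
  | add p q hp hq =>
    simp only [linePoly, polyEval, map_add, Polynomial.eval_add] at hp hq ⊢
    rw [hp, hq]
  | mul_X p ξ hp =>
    simp only [linePoly, polyEval, map_mul, Polynomial.eval_mul] at hp ⊢
    rw [hp]
    simp [mul_comm t]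

theorem eval_derivative_linePoly (x v : M) (p : MvPolynomial (Module.Dual ℂ M) ℂ) :
    (linePoly x v p).derivative.eval 0 = polyEval (polyDeriv v p) x := by
  induction p using MvPolynomial.induction_on with
  | C c => simp [linePoly, polyEval, polyDeriv]
  | add p q hp hq =>
    simp only [linePoly, polyEval, polyDeriv, map_add, Polynomial.eval_add] at hp hq ⊢
    rw [hp, hq]
  | mul_X p ξ hp =>
    have h0 := eval_linePoly x v p 0
    simp only [zero_smul, add_zero] at h0
    simp only [linePoly, polyEval, polyDeriv, map_mul, Polynomial.derivative_mul,
      Polynomial.eval_add, Polynomial.eval_mul, Derivation.leibniz, map_add, smul_eq_mul,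
      MvPolynomial.mkDerivation_X] at hp h0 ⊢
    rw [hp, h0]
    simp
    ring

/-- A polynomial vanishing on `Y` restricts to the line as a one-variable polynomial with infinitely
many roots, so its derivative at `0` vanishes too. Finitely many exceptions are allowed because `1 +
t x` may be singular for some `t`. -/
theorem mem_zariskiTangent_of_finite {Y : Set M} {x v : M}
    (h : {t : ℂ | x + t • v ∉ Y}.Finite) : v ∈ zariskiTangent Y x := by
  intro p hp
  have h0 : linePoly x v p = 0 := by
    refine Polynomial.eq_zero_of_infinite_isRoot _ (h.infinite_compl.mono fun t ht => ?_)
    have ht' : x + t • v ∈ Y := by simpa using ht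
    simpa [Polynomial.IsRoot, eval_linePoly] using hp _ ht'
  rw [← eval_derivative_linePoly, h0]
  simp

end Line

/-- If `1 + t x` is singular then `t ≠ 0` and `-t⁻¹` is an eigenvalue of `x`. -/
theorem finite_not_isUnit_one_add_smul {E : Type*} [AddCommGroup E] [Module ℂ E]
    [FiniteDimensional ℂ E] (x : Module.End ℂ E) :
    {t : ℂ | ¬ IsUnit (1 + t • x)}.Finite := by
  have hf : (spectrum ℂ x).Finite := Module.End.finite_spectrum x
  refine (hf.preimage (f := fun t : ℂ => -t⁻¹) ?_).subset fun t ht => ?_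
  · intro s _ t _ hst
    simpa using hst
  · have ht0 : t ≠ 0 := by
      rintro rfl
      simp at ht
    show -t⁻¹ ∈ spectrum ℂ x
    rw [spectrum.mem_iff]
    intro hu
    apply ht
    have h1 : (1 + t • x) = (Units.mk0 (-t) (neg_ne_zero.2 ht0)) •
        (algebraMap ℂ (Module.End ℂ E) (-t⁻¹) - x) := by
      ext v
      simp [Units.smul_def, smul_sub, smul_smul, ht0]
    rw [h1]
    exact hu.smul _

/-! ### Coordinate subspaces -/

section Coord

variable {E : Type*} [AddCommGroup E] [Module ℂ E] {κ : Type*}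

/-- `U` is the span of the basis vectors `b t`, `t ∈ S`. -/
def IsCoord (b : Basis κ ℂ E) (U : Submodule ℂ E) (S : Finset κ) : Prop :=
  ∀ v, v ∈ U ↔ ∀ t, t ∉ S → b.repr v t = 0

variable {b : Basis κ ℂ E} {U V : Submodule ℂ E} {S T : Finset κ}

theorem IsCoord.eq_span (h : IsCoord b U S) : U = Submodule.span ℂ (b '' (S : Set κ)) := by
  ext v
  rw [h v, Basis.mem_span_image]
  simp only [Set.subset_def, Finset.mem_coe, Finsupp.mem_support_iff]
  exact forall_congr' fun t => not_imp_comm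

theorem isCoord_span (b : Basis κ ℂ E) (S : Finset κ) :
    IsCoord b (Submodule.span ℂ (b '' (S : Set κ))) S := by
  intro v
  rw [Basis.mem_span_image]
  simp only [Set.subset_def, Finset.mem_coe, Finsupp.mem_support_iff]
  exact forall_congr' fun t => not_imp_comm

theorem IsCoord.finrank_eq (h : IsCoord b U S) : finrank ℂ U = S.card := by
  have h1 : U = Submodule.span ℂ (Set.range fun t : S => b t) := by
    rw [h.eq_span]
    congr 1
    ext v
    simp
  have h2 := finrank_span_eq_card
    (b.linearIndependent.comp (Subtype.val : S → κ) Subtype.val_injective)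
  rw [h1]
  exact h2.trans (Fintype.card_coe S)

variable [DecidableEq κ]

theorem IsCoord.mem_basis (h : IsCoord b U S) (t : κ) : b t ∈ U ↔ t ∈ S := by
  rw [h]
  constructor
  · intro h1
    by_contra ht
    simpa using h1 t ht
  · intro ht s hs
    simp [show t ≠ s from fun h => hs (h ▸ ht)]

theorem IsCoord.inf (hU : IsCoord b U S) (hV : IsCoord b V T) : IsCoord b (U ⊓ V) (S ∩ T) := by
  intro v
  rw [Submodule.mem_inf, hU, hV]
  constructor
  · rintro ⟨h1, h2⟩ t ht
    by_cases h : t ∈ S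
    · exact h2 t fun h' => ht (Finset.mem_inter.2 ⟨h, h'⟩)
    · exact h1 t h
  · intro h
    exact ⟨fun t ht => h t fun h' => ht (Finset.mem_inter.1 h').1,
      fun t ht => h t fun h' => ht (Finset.mem_inter.1 h').2⟩

theorem IsCoord.sup (hU : IsCoord b U S) (hV : IsCoord b V T) : IsCoord b (U ⊔ V) (S ∪ T) := by
  rw [hU.eq_span, hV.eq_span, ← Submodule.span_union, ← Set.image_union, ← Finset.coe_union]
  exact isCoord_span b _

/-! ### Equations of rank loci -/

/-- The minor of `g` with rows `s` and `T` and columns `t` and `T`, as a polynomial in `g`. -/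
def borderedMinor (b : Basis κ ℂ E) (T : Finset κ) (s t : κ) :
    MvPolynomial (Module.Dual ℂ (Module.End ℂ E)) ℂ :=
  Matrix.det (Matrix.of fun p q : Unit ⊕ T => MvPolynomial.X
    (b.coord (p.elim (fun _ => s) Subtype.val) ∘ₗ
      LinearMap.applyₗ (b (q.elim (fun _ => t) Subtype.val))))

theorem polyEval_borderedMinor (T : Finset κ) (s t : κ) (g : Module.End ℂ E) :
    polyEval (borderedMinor b T s t) g = Matrix.det (Matrix.of fun p q : Unit ⊕ T =>
      b.repr (g (b (q.elim (fun _ => t) Subtype.val))) (p.elim (fun _ => s) Subtype.val)) := by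
  rw [polyEval, borderedMinor, RingHom.map_det]
  congr 1
  ext p q
  simp

/-- Row `s` of the minor is zero at the identity, so along `1 + X x` it is divisible by `X`. The
derivative at `0` is therefore the determinant with that row replaced by the row of `x`. The other
rows are those of the identity, which makes the matrix block triangular with the `(s, t)` entry of
`x` in the corner. -/
theorem polyEval_polyDeriv_borderedMinor {T : Finset κ} {s t : κ} (hs : s ∉ T) (ht : t ∉ T)
    (hst : s ≠ t) (x : Module.End ℂ E) :
    polyEval (polyDeriv x (borderedMinor b T s t)) 1 = b.repr (x (b t)) s := by
  set σ : Unit ⊕ T → κ := fun p => p.elim (fun _ => s) Subtype.val with hσ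
  set τ : Unit ⊕ T → κ := fun p => p.elim (fun _ => t) Subtype.val with hτ
  have h1 : linePoly 1 x (borderedMinor b T s t) = Polynomial.X * Matrix.det
      (Matrix.updateRow (Matrix.of fun p q : Unit ⊕ T =>
        (Polynomial.C (b.repr (b (τ q)) (σ p)) +
          Polynomial.X * Polynomial.C (b.repr (x (b (τ q))) (σ p)) : Polynomial ℂ)) (Sum.inl ())
        (fun q => Polynomial.C (b.repr (x (b (τ q))) s))) := by
    rw [← Matrix.det_updateRow_smul, linePoly, borderedMinor, AlgHom.map_det]
    congr 1
    ext1 p q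
    rcases p with p | p
    · have h0 : b.repr (b (τ q)) s = 0 := by
        rcases q with q | q
        · simp [hτ, hst.symm]
        · have : (q : κ) ≠ s := fun h => hs (h ▸ q.2)
          simp [hτ, this]
      have h0' : Finsupp.single (τ q) (1 : ℂ) s = 0 := by simpa using h0
      simp [Matrix.updateRow_apply, hτ.symm, h0']
    · simp [Matrix.updateRow_apply, hσ, hτ]
  rw [← eval_derivative_linePoly, h1, Polynomial.derivative_mul]
  simp only [Polynomial.derivative_X, one_mul, Polynomial.eval_add, Polynomial.eval_mul,
    Polynomial.eval_X, zero_mul, add_zero]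
  rw [← Polynomial.coe_evalRingHom, RingHom.map_det]
  have h2 : (Polynomial.evalRingHom 0).mapMatrix
      (Matrix.updateRow (Matrix.of fun p q : Unit ⊕ T =>
        (Polynomial.C (b.repr (b (τ q)) (σ p)) +
          Polynomial.X * Polynomial.C (b.repr (x (b (τ q))) (σ p)) : Polynomial ℂ)) (Sum.inl ())
        (fun q => Polynomial.C (b.repr (x (b (τ q))) s))) =
      Matrix.fromBlocks (Matrix.of fun _ _ : Unit => b.repr (x (b t)) s)
        (Matrix.of fun (_ : Unit) (q : T) => b.repr (x (b q)) s) 0 1 := by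
    ext p q
    rcases p with p | p <;> rcases q with q | q
    · simp [hτ]
    · simp [hτ]
    · have : t ≠ p := fun h => ht (h ▸ p.2)
      simp [hσ, hτ, Matrix.updateRow_apply, Finsupp.single_apply, this]
    · rw [Matrix.fromBlocks_apply₂₂]
      by_cases hpq : p = q
      · subst hpq
        simp [hσ, hτ, Matrix.updateRow_apply]
      · have h3 : (q : κ) ≠ p := fun h => hpq (Subtype.ext h.symm)
        simp [hσ, hτ, Matrix.updateRow_apply, hpq, Finsupp.single_apply, h3]
  rw [h2, Matrix.det_fromBlocks_zero₂₁]
  simp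

/-- A nonzero minor would give `#(S \ T) + 1` vectors of `g V` independent modulo `U`. Together with
`g V ∩ U`, of dimension `#(S ∩ T)`, they would span more than `#S = dim V` dimensions. -/
theorem polyEval_borderedMinor_eq_zero [Finite κ] (hV : IsCoord b V S) (hU : IsCoord b U T) {s t : κ}
    (htS : t ∈ S) (hsT : s ∉ T) {g : Module.End ℂ E}
    (h : finrank ℂ (V.map g ⊓ U : Submodule ℂ E) = finrank ℂ (V ⊓ U : Submodule ℂ E)) :
    polyEval (borderedMinor b (S \ T) s t) g = 0 := by
  have : FiniteDimensional ℂ E := b.finiteDimensional_of_finite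
  by_contra hne
  rw [polyEval_borderedMinor] at hne
  set τ : Unit ⊕ (S \ T : Finset κ) → κ := fun p => p.elim (fun _ => t) Subtype.val with hτ
  set N := Matrix.of fun p q : Unit ⊕ (S \ T : Finset κ) =>
      b.repr (g (b (τ q))) (p.elim (fun _ => s) Subtype.val) with hN
  let φ : (Unit ⊕ (S \ T : Finset κ) → ℂ) →ₗ[ℂ] E :=
    Fintype.linearCombination ℂ fun q => g (b (τ q))
  -- The row indices `s` and `S \ T` all avoid `T`, so these coordinates vanish on `U`, and the
  -- invertible minor forces `c = 0`.
  have hφ : ∀ c, φ c ∈ U → c = 0 := by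
    intro c hc
    refine Matrix.eq_zero_of_mulVec_eq_zero hne ?_
    ext p
    have h1 := (hU _).1 hc (p.elim (fun _ => s) Subtype.val) (by
      rcases p with p | p
      · exact hsT
      · exact (Finset.mem_sdiff.1 p.2).2)
    rw [Pi.zero_apply, ← h1]
    simp [φ, Matrix.mulVec, dotProduct, Fintype.linearCombination_apply, hN, mul_comm]
  have hφV : LinearMap.range φ ≤ V.map g := by
    rintro _ ⟨c, rfl⟩
    simp only [φ, Fintype.linearCombination_apply]
    refine Submodule.sum_mem _ fun q _ => Submodule.smul_mem _ _ ⟨_, (hV.mem_basis _).2 ?_, rfl⟩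
    rcases q with q | q
    · exact htS
    · exact (Finset.mem_sdiff.1 q.2).1
  have hinj : Function.Injective φ := by
    rw [← LinearMap.ker_eq_bot, LinearMap.ker_eq_bot']
    intro c hc
    exact hφ c (hc ▸ U.zero_mem)
  have hdisj : LinearMap.range φ ⊓ (V.map g ⊓ U) = ⊥ := by
    rw [eq_bot_iff]
    rintro _ ⟨⟨c, rfl⟩, -, hc⟩
    rw [hφ c hc]
    simp
  have h1 := Submodule.finrank_sup_add_finrank_inf_eq (LinearMap.range φ) (V.map g ⊓ U)
  rw [hdisj, finrank_bot, add_zero, LinearMap.finrank_range_of_inj hinj, h,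
    (hV.inf hU).finrank_eq] at h1
  have h2 : finrank ℂ (LinearMap.range φ ⊔ (V.map g ⊓ U) : Submodule ℂ E) ≤ S.card := by
    rw [← hV.finrank_eq]
    exact (Submodule.finrank_mono (sup_le hφV inf_le_left)).trans (Submodule.finrank_map_le g V)
  rw [h1] at h2
  have h3 := Finset.card_sdiff_add_card_inter S T
  simp only [finrank_fintype_fun_eq_card, Fintype.card_sum, Fintype.card_unit,
    Fintype.card_coe] at h2
  omega

end Coord

/-! ### Tangent spaces of Schubert cells -/

section Cell

variable {E : Type*} [AddCommGroup E] [Module ℂ E] {ι : Type*}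

/-- The endomorphisms `x` with `x (V_k ∩ U) ⊆ V_k + U` for all `k` and all `U ∈ F`. -/
def rankTangent (F : Flag (Submodule ℂ E)) (V : ι → Submodule ℂ E) :
    Submodule ℂ (Module.End ℂ E) :=
  ⨅ k, ⨅ U ∈ F, Submodule.compatibleMaps (V k ⊓ U) (V k ⊔ U)

theorem mem_rankTangent {F : Flag (Submodule ℂ E)} {V : ι → Submodule ℂ E} {x : Module.End ℂ E} :
    x ∈ rankTangent F V ↔ ∀ k, ∀ U ∈ F, ∀ v ∈ V k, v ∈ U → x v ∈ V k ⊔ U := by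
  simp [rankTangent, Submodule.mem_iInf, Submodule.compatibleMaps, SetLike.le_def]

theorem orbitDifferential_eq_zero_iff {V : ι → Submodule ℂ E} {x : Module.End ℂ E} :
    orbitDifferential V x = 0 ↔ ∀ k, ∀ v ∈ V k, x v ∈ V k := by
  simp only [funext_iff, LinearMap.ext_iff, orbitDifferential]
  simp

theorem orbitDifferential_eq_iff {V : ι → Submodule ℂ E} {x y : Module.End ℂ E} :
    orbitDifferential V x = orbitDifferential V y ↔ ∀ k, ∀ v ∈ V k, (x - y) v ∈ V k := by
  simp only [funext_iff, LinearMap.ext_iff, orbitDifferential]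
  simp [Submodule.Quotient.eq]

/-- Allows membership in a space of tangent vectors to be tested on any endomorphism representing
the vector. -/
theorem orbitDifferential_mem_map_iff {V : ι → Submodule ℂ E} {C : Submodule ℂ (Module.End ℂ E)}
    (hC : LinearMap.ker (orbitDifferential V) ≤ C) {x : Module.End ℂ E} :
    orbitDifferential V x ∈ C.map (orbitDifferential V) ↔ x ∈ C := by
  rw [← Submodule.mem_comap, Submodule.comap_map_eq_self hC]

theorem ker_orbitDifferential_le_rankTangent (F : Flag (Submodule ℂ E)) (V : ι → Submodule ℂ E) :
    LinearMap.ker (orbitDifferential V) ≤ rankTangent F V := by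
  intro x hx
  rw [LinearMap.mem_ker, orbitDifferential_eq_zero_iff] at hx
  rw [mem_rankTangent]
  intro k U _ v hv _
  exact Submodule.mem_sup_left (hx k v hv)

theorem orbitDifferential_mem_map_rankTangent {F : Flag (Submodule ℂ E)} {V : ι → Submodule ℂ E}
    {x : Module.End ℂ E} :
    orbitDifferential V x ∈ (rankTangent F V).map (orbitDifferential V) ↔ x ∈ rankTangent F V :=
  orbitDifferential_mem_map_iff (ker_orbitDifferential_le_rankTangent F V)

theorem finrank_map_of_isUnit {g : Module.End ℂ E} (hg : IsUnit g) (U : Submodule ℂ E) :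
    finrank ℂ (U.map g) = finrank ℂ U :=
  LinearEquiv.finrank_map_eq (LinearEquiv.ofBijective g ((Module.End.isUnit_iff g).1 hg)) U

theorem map_mem_flagVariety [Preorder ι] {d : ι → ℕ} {V : ι → Submodule ℂ E}
    (hV : V ∈ flagVariety E d) {g : Module.End ℂ E} (hg : IsUnit g) :
    (fun k => (V k).map g) ∈ flagVariety E d :=
  ⟨fun _ _ h => Submodule.map_mono (hV.1 h), fun k => by
    rw [finrank_map_of_isUnit hg, hV.2 k]⟩

variable [FiniteDimensional ℂ E]

theorem map_eq_of_isUnit {g : Module.End ℂ E} (hg : IsUnit g) {U : Submodule ℂ E}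
    (h : ∀ u ∈ U, g u ∈ U) : U.map g = U := by
  exact Submodule.eq_of_le_of_finrank_eq (Submodule.map_le_iff_le_comap.2 h)
    (finrank_map_of_isUnit hg U)

/-- Since `g U = U`, one has `g V_k ∩ U = g (V_k ∩ U)`, and no dimension changes. -/
theorem map_mem_schubertCell [Preorder ι] {m : ℕ} {d : ι → ℕ} {w : Equiv.Perm (Fin m)}
    {F : Flag (Submodule ℂ E)} {V : ι → Submodule ℂ E} (hV : V ∈ schubertCell d w F)
    {g : Module.End ℂ E} (hg : IsUnit g) (hF : ∀ U ∈ F, ∀ u ∈ U, g u ∈ U) :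
    (fun k => (V k).map g) ∈ schubertCell d w F := by
  refine ⟨map_mem_flagVariety hV.1 hg, fun k U hU => ?_⟩
  rw [← hV.2 k U hU, ← finrank_map_of_isUnit hg (V k ⊓ U),
    Submodule.map_inf g ((Module.End.isUnit_iff g).1 hg).1, map_eq_of_isUnit hg (hF U hU)]

theorem tangentSpace_flagVariety [Preorder ι] {d : ι → ℕ} {V : ι → Submodule ℂ E}
    (hV : V ∈ flagVariety E d) :
    tangentSpace (flagVariety E d) V = LinearMap.range (orbitDifferential V) := by
  rw [tangentSpace, ← Submodule.map_top]
  congr 1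
  rw [eq_top_iff]
  intro x _
  refine mem_zariskiTangent_of_finite ((finite_not_isUnit_one_add_smul x).subset fun t ht hu => ?_)
  exact ht ⟨hu, map_mem_flagVariety hV hu⟩

/-- The adapted basis reduces both inclusions to single matrix entries: minors bound the tangent
space from above, and lines through `1` in the directions of elementary matrices fill it. -/
theorem tangentSpace_schubertCell [Preorder ι] {m : ℕ} {d : ι → ℕ} {w : Equiv.Perm (Fin m)}
    {F : Flag (Submodule ℂ E)} {V : ι → Submodule ℂ E} (hV : V ∈ schubertCell d w F)
    {κ : Type*} [Fintype κ] [DecidableEq κ] (b : Basis κ ℂ E)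
    (hbV : ∀ k, ∃ S, IsCoord b (V k) S) (hbF : ∀ U ∈ F, ∃ S, IsCoord b U S) :
    tangentSpace (schubertCell d w F) V = (rankTangent F V).map (orbitDifferential V) := by
  rw [tangentSpace]
  apply le_antisymm
  · refine Submodule.map_mono fun x hx => mem_rankTangent.2 fun k U hU v hv hvU => ?_
    obtain ⟨S, hS⟩ := hbV k
    obtain ⟨T, hT⟩ := hbF U hU
    have key : ∀ s t, t ∈ S → t ∈ T → s ∉ S → s ∉ T → b.repr (x (b t)) s = 0 := by
      intro s t htS htT hsS hsT
      rw [← polyEval_polyDeriv_borderedMinor (T := S \ T) (s := s) (t := t) (by simp [hsS])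
        (by simp [htT]) (fun h => hsS (h ▸ htS)) x]
      refine hx _ fun g hg => polyEval_borderedMinor_eq_zero hS hT htS hsT ?_
      rw [hV.2 k U hU]
      exact hg.2.2 k U hU
    rw [hS.sup hT]
    intro s hs
    rw [Finset.mem_union, not_or] at hs
    have hxv : x v = ∑ t, b.repr v t • x (b t) := by
      conv_lhs => rw [← b.sum_repr v, map_sum]
      simp only [map_smul]
    rw [hxv]
    simp only [map_sum, map_smul, Finsupp.coe_finsetSum, Finset.sum_apply, Finsupp.smul_apply,
      smul_eq_mul]
    refine Finset.sum_eq_zero fun t _ => ?_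
    by_cases htS : t ∈ S
    · by_cases htT : t ∈ T
      · rw [key s t htS htT hs.1 hs.2, mul_zero]
      · rw [(hT v).1 hvU t htT, zero_mul]
    · rw [(hS v).1 hv t htS, zero_mul]
  · rintro _ ⟨x, hx, rfl⟩
    have hx' := mem_rankTangent.1 hx
    -- `e s t` is the elementary matrix sending `b t` to `b s` and the other basis vectors to zero.
    let e : κ → κ → Module.End ℂ E := fun s t => (b.coord t).smulRight (b s)
    have he : ∀ s t v, e s t v = b.repr v t • b s := fun s t v => rfl
    have hsum : x = ∑ s, ∑ t, b.repr (x (b t)) s • e s t := by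
      refine b.ext fun t => ?_
      simp only [LinearMap.sum_apply, LinearMap.smul_apply, he]
      simp only [Basis.repr_self, Finsupp.single_apply, ite_smul, one_smul, zero_smul, smul_ite,
        smul_zero, Finset.sum_ite_eq, Finset.mem_univ, if_true]
      exact (b.sum_repr _).symm
    rw [hsum]
    simp only [map_sum, map_smul]
    refine Submodule.sum_mem _ fun s _ => Submodule.sum_mem _ fun t _ => ?_
    by_cases hst : b.repr (x (b t)) s = 0
    · rw [hst, zero_smul]
      exact Submodule.zero_mem _
    refine Submodule.smul_mem _ _ ?_
    by_cases hk : ∀ k, b t ∈ V k → b s ∈ V k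
    · have : orbitDifferential V (e s t) = 0 := by
        rw [orbitDifferential_eq_zero_iff]
        intro k v hv
        rw [he]
        obtain ⟨S, hS⟩ := hbV k
        by_cases ht : t ∈ S
        · exact Submodule.smul_mem _ _ (hk k ((hS.mem_basis t).2 ht))
        · rw [(hS v).1 hv t ht, zero_smul]
          exact Submodule.zero_mem _
      rw [this]
      exact Submodule.zero_mem _
    · push Not at hk
      obtain ⟨k, htk, hsk⟩ := hk
      obtain ⟨S, hS⟩ := hbV k
      -- As `b t ∈ V k` and `b s ∉ V k`, the condition on `x` at this one `k` forces `b s ∈ U`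
      -- whenever `b t ∈ U`; otherwise the entry `(s, t)` of `x` would be zero.
      have hF : ∀ U ∈ F, ∀ u ∈ U, e s t u ∈ U := by
        intro U hU u hu
        obtain ⟨T, hT⟩ := hbF U hU
        rw [he]
        by_cases ht : t ∈ T
        · refine Submodule.smul_mem _ _ ?_
          by_contra hs
          have h1 := hx' k U hU (b t) htk ((hT.mem_basis t).2 ht)
          rw [hS.sup hT] at h1
          refine hst (h1 s ?_)
          rw [hS.mem_basis] at hsk
          rw [hT.mem_basis] at hs
          simp [hsk, hs]
        · rw [(hT u).1 hu t ht, zero_smul]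
          exact Submodule.zero_mem _
      refine Submodule.mem_map_of_mem (mem_zariskiTangent_of_finite
        ((finite_not_isUnit_one_add_smul (e s t)).subset fun c hc hu => hc ⟨hu, ?_⟩))
      refine map_mem_schubertCell hV hu fun U hU u hu' => ?_
      simpa using U.add_mem hu' (U.smul_mem c (hF U hU u hu'))

end Cell

/-! ### Flattenings and blocks -/

section Combinatorics

/-- A lower set of `Fin m` is an initial segment, hence determined by its size. This turns
membership in blocks and bounds on values of `w` into the numerical conditions on flattenings. -/
theorem mem_iff_lt_card_of_isLowerSet {m : ℕ} {D : Finset (Fin m)}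
    (hD : ∀ s ∈ D, ∀ t, t ≤ s → t ∈ D) (s : Fin m) : s ∈ D ↔ s.val < D.card := by
  constructor
  · intro hs
    have h := Finset.card_le_card (show Finset.Iic s ⊆ D from
      fun t ht => hD s hs t (Finset.mem_Iic.1 ht))
    rw [Fin.card_Iic] at h
    omega
  · intro hs
    by_contra hn
    have h := Finset.card_le_card (show D ⊆ Finset.Iio s from fun t ht => by
      rw [Finset.mem_Iio]
      by_contra hts
      exact hn (hD t ht s (not_lt.1 hts)))
    rw [Fin.card_Iio] at h
    omega

variable {n : ℕ}

theorem card_filter_orderEmbOfFin (A : Finset (Fin n)) (P : Fin n → Prop) [DecidablePred P] :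
    (Finset.univ.filter fun s => P (A.orderEmbOfFin rfl s)).card = (A.filter P).card := by
  conv_rhs => rw [← A.map_orderEmbOfFin_univ rfl, Finset.filter_map, Finset.card_map]
  rfl

theorem orderEmbOfFin_mem_iff {A B : Finset (Fin n)} (hBA : B ⊆ A)
    (hB : ∀ x ∈ B, ∀ y ∈ A, y ≤ x → y ∈ B) (s : Fin A.card) :
    A.orderEmbOfFin rfl s ∈ B ↔ s.val < B.card := by
  have h := mem_iff_lt_card_of_isLowerSet
    (D := Finset.univ.filter fun s => A.orderEmbOfFin rfl s ∈ B) (by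
      intro s hs t hts
      simp only [Finset.mem_filter, Finset.mem_univ, true_and] at hs ⊢
      exact hB _ hs _ (A.orderEmbOfFin_mem rfl t) ((A.orderEmbOfFin rfl).monotone hts)) s
  rw [card_filter_orderEmbOfFin (P := fun t => t ∈ B), Finset.filter_mem_eq_inter, Finset.inter_eq_right.2 hBA] at h
  simpa using h

theorem flatten_lt_card_iff (w : Equiv.Perm (Fin n)) (A : Finset (Fin n)) (j : ℕ)
    (s : Fin A.card) :
    (flatten w A s).val < (A.filter fun t => (w t).val < j).card ↔
      (w (A.orderEmbOfFin rfl s)).val < j := by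
  have h := mem_iff_lt_card_of_isLowerSet
    (D := (Finset.univ.filter fun s => (w (A.orderEmbOfFin rfl s)).val < j).map
      (flatten w A).toEmbedding) (by
      intro s hs t hts
      obtain ⟨s, rfl⟩ := (flatten w A).surjective s
      obtain ⟨t, rfl⟩ := (flatten w A).surjective t
      rw [← not_lt, flatten_lt_iff, not_lt, Fin.le_def] at hts
      simp at hs ⊢
      omega) (flatten w A s)
  rw [Finset.card_map, card_filter_orderEmbOfFin (P := fun t => (w t).val < j)] at h
  rw [← h]
  simp

/-- Flattening preserves relative order, so the initial segment `B` of positions and the values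
below `j` become initial segments of the same sizes. The cutoff for the values is the dimension of
the induced flag member. -/
theorem card_filter_flatten (w : Equiv.Perm (Fin n)) {A B : Finset (Fin n)} (hBA : B ⊆ A)
    (hB : ∀ x ∈ B, ∀ y ∈ A, y ≤ x → y ∈ B) (j : ℕ) :
    (Finset.univ.filter fun s : Fin A.card => s.val < B.card ∧
      (flatten w A s).val < (A.filter fun t => (w t).val < j).card).card =
      (B.filter fun t => (w t).val < j).card := by
  simp only [flatten_lt_card_iff, ← orderEmbOfFin_mem_iff hBA hB]
  rw [card_filter_orderEmbOfFin (P := fun t => t ∈ B ∧ (w t).val < j)]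
  congr 1
  ext t
  simp only [Finset.mem_filter]
  exact ⟨fun h => h.2, fun h => ⟨hBA h.1, h⟩⟩

theorem card_filter_perm_lt (w : Equiv.Perm (Fin n)) {j : ℕ} (hj : j ≤ n) :
    (Finset.univ.filter fun t => (w t).val < j).card = j := by
  have h : (Finset.univ.filter fun t => (w t).val < j) =
      (Finset.univ.filter fun t : Fin n => t.val < j).map w.symm.toEmbedding := by
    ext t
    simp
  rw [h, Finset.card_map, Fin.card_filter_val_lt, min_eq_right hj]

/-! ### Blocks of indices and minimal representatives. -/

variable {r : ℕ} {a : Fin (r + 2) → ℕ}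

theorem mem_block {i : Fin (r + 1)} {t : Fin n} :
    t ∈ block n a i ↔ a i.castSucc ≤ t.val ∧ t.val < a i.succ := by
  simp [block]

theorem card_block (ha : StrictMono a) (han : a (Fin.last (r + 1)) = n) (i : Fin (r + 1)) :
    (block n a i).card = blockSize a i := by
  have h1 : a i.succ ≤ n := han ▸ ha.monotone (Fin.le_last _)
  have h2 : (block n a i).map Fin.valEmbedding = Finset.Ico (a i.castSucc) (a i.succ) := by
    ext t
    simp only [Finset.mem_map, mem_block, Finset.mem_Ico, Fin.valEmbedding_apply]
    constructor
    · rintro ⟨t, ht, rfl⟩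
      exact ht
    · intro ht
      exact ⟨⟨t, by omega⟩, ht, rfl⟩
  rw [← Finset.card_map, h2, Nat.card_Ico, blockSize]

theorem lt_of_mem_block (ha : StrictMono a) {i j : Fin (r + 1)} (hij : i < j) {s t : Fin n}
    (hs : s ∈ block n a i) (ht : t ∈ block n a j) : s < t := by
  rw [mem_block] at hs ht
  have h : a i.succ ≤ a j.castSucc := ha.monotone (by
    rw [Fin.le_def]; simpa using Nat.succ_le_of_lt hij)
  rw [Fin.lt_def]
  omega

theorem disjoint_block (ha : StrictMono a) {i j : Fin (r + 1)} (hij : i ≠ j) :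
    Disjoint (block n a i) (block n a j) := by
  rw [Finset.disjoint_left]
  intro t hi hj
  rcases lt_or_gt_of_ne hij with h | h
  · exact lt_irrefl _ (lt_of_mem_block ha h hi hj)
  · exact lt_irrefl _ (lt_of_mem_block ha h hj hi)

theorem card_block_union (ha : StrictMono a) (han : a (Fin.last (r + 1)) = n) {i j : Fin (r + 1)}
    (hij : i ≠ j) : (block n a i ∪ block n a j).card = blockSize a i + blockSize a j := by
  rw [Finset.card_union_of_disjoint (disjoint_block ha hij), card_block ha han, card_block ha han]

theorem exists_mem_block (ha0 : a 0 = 0) (han : a (Fin.last (r + 1)) = n)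
    (t : Fin n) : ∃ i, t ∈ block n a i := by
  by_contra! h
  have key : ∀ m : Fin (r + 2), a m ≤ t.val := by
    intro m
    induction m using Fin.induction with
    | zero => omega
    | succ i hi =>
      by_contra hlt
      exact h i (mem_block.2 ⟨hi, by omega⟩)
  have := key (Fin.last (r + 1))
  omega

theorem block_isLowerSet (ha : StrictMono a) {i j : Fin (r + 1)} (hij : i < j) :
    ∀ x ∈ block n a i, ∀ y ∈ block n a i ∪ block n a j, y ≤ x → y ∈ block n a i := by
  intro x hx y hy hyx
  rcases Finset.mem_union.1 hy with h | h
  · exact h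
  · exact absurd (lt_of_mem_block ha hij hx h) (not_lt.2 hyx)

/-- No step lies strictly inside a block, so the ascents at adjacent positions chain together. -/
theorem IsMinimalRep.lt_of_mem_block (ha : StrictMono a) {w : Equiv.Perm (Fin n)}
    (hw : IsMinimalRep (steps a) w) {i : Fin (r + 1)} {s t : Fin n} (hs : s ∈ block n a i)
    (ht : t ∈ block n a i) (hst : s < t) : w s < w t := by
  rw [mem_block] at hs ht
  have key : ∀ m : ℕ, ∀ hm : m < n, s.val < m → m < a i.succ → w s < w ⟨m, hm⟩ := by
    intro m
    induction m with
    | zero => intro _ h; omega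
    | succ m ih =>
      intro hm hsm hma
      have h1 : w ⟨m, by omega⟩ < w ⟨m + 1, hm⟩ := by
        refine hw _ _ rfl fun k hk => ?_
        simp only [steps] at hk
        have h2 : a i.castSucc < a k.succ.castSucc := by omega
        have h3 : a k.succ.castSucc < a i.succ := by omega
        rw [ha.lt_iff_lt, Fin.lt_def] at h2 h3
        simp at h2 h3
        omega
      rcases Nat.lt_succ_iff_lt_or_eq.1 hsm with h | h
      · exact (ih (by omega) h (by omega)).trans h1
      · have : s = ⟨m, by omega⟩ := Fin.ext h
        rwa [← this] at h1
  exact key t.val t.2 hst ht.2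

/-- Block `i` occupies the first `blockSize a i` positions of the union. Adjacent positions not
separated by that boundary come from one block, where `w` increases. -/
theorem IsMinimalRep.flatten (ha : StrictMono a) (han : a (Fin.last (r + 1)) = n)
    {w : Equiv.Perm (Fin n)} (hw : IsMinimalRep (steps a) w) {i j : Fin (r + 1)} (hij : i < j) :
    IsMinimalRep (fun _ : Unit => blockSize a i)
      (SchubertTangent.flatten w (block n a i ∪ block n a j)) := by
  intro p q hpq hq
  rw [flatten_lt_iff]
  have hlt : (block n a i ∪ block n a j).orderEmbOfFin rfl p <
      (block n a i ∪ block n a j).orderEmbOfFin rfl q :=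
    (OrderEmbedding.lt_iff_lt _).2 (by rw [Fin.lt_def]; omega)
  have hmem := fun s => orderEmbOfFin_mem_iff (A := block n a i ∪ block n a j)
    Finset.subset_union_left (block_isLowerSet ha hij) s
  simp only [card_block ha han] at hmem
  have hq' : q.val ≠ blockSize a i := hq ()
  by_cases h : q.val < blockSize a i
  · exact hw.lt_of_mem_block ha ((hmem p).2 (by omega)) ((hmem q).2 h) hlt
  · have hj : ∀ s, ¬ s.val < blockSize a i →
        (block n a i ∪ block n a j).orderEmbOfFin rfl s ∈ block n a j := fun s hs =>
      (Finset.mem_union.1 (Finset.orderEmbOfFin_mem _ rfl s)).resolve_left fun h' =>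
        hs ((hmem s).1 h')
    exact hw.lt_of_mem_block ha (hj p (by omega)) (hj q h) hlt

end Combinatorics

/-! ### Bases of coordinate subspaces -/

section Restrict

variable {E : Type*} [AddCommGroup E] [Module ℂ E] {κ : Type*} {b : Basis κ ℂ E}
  {W : Submodule ℂ E} {S : Finset κ}

theorem IsCoord.exists_basis [DecidableEq κ] (h : IsCoord b W S) :
    ∃ g : Basis S ℂ W, ∀ t, (g t : E) = b t := by
  have hli : LinearIndependent ℂ (fun t : S => (⟨b t, (h.mem_basis _).2 t.2⟩ : W)) := by
    refine LinearIndependent.of_comp W.subtype ?_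
    exact b.linearIndependent.comp (Subtype.val : S → κ) Subtype.val_injective
  have hsp : ⊤ ≤ Submodule.span ℂ
      (Set.range (fun t : S => (⟨b t, (h.mem_basis _).2 t.2⟩ : W))) := by
    refine le_of_eq (Submodule.map_injective_of_injective W.injective_subtype ?_)
    rw [Submodule.map_subtype_top, Submodule.map_span, ← Set.range_comp]
    conv_lhs => rw [h.eq_span]
    congr 1
    ext v
    simp
  exact ⟨Basis.mk hli hsp, fun t => by simp⟩

theorem IsCoord.comap_subtype [DecidableEq κ] (h : IsCoord b W S) {g : Basis S ℂ W}
    (hg : ∀ t, (g t : E) = b t) {U : Submodule ℂ E} {T : Finset κ} (hU : IsCoord b U T) :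
    IsCoord g (U.comap W.subtype) (T.subtype (· ∈ S)) := by
  have key : ∀ (v : W) (t : S), b.repr v t = g.repr v t := by
    intro v t
    have h1 : b.coord t ∘ₗ W.subtype = g.coord t := by
      refine g.ext fun s => ?_
      by_cases hst : s = t
      · subst hst
        simp [hg]
      · have hst' : (s : κ) ≠ t := fun h => hst (Subtype.ext h)
        simp [hg, hst, hst']
    exact LinearMap.congr_fun h1 v
  intro v
  rw [Submodule.mem_comap, hU]
  constructor
  · intro h1 t ht
    rw [← key]
    exact h1 t (by simpa using ht)
  · intro h1 t ht
    by_cases hS : t ∈ S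
    · exact (key v ⟨t, hS⟩).trans (h1 ⟨t, hS⟩ (by simpa using ht))
    · exact (h _).1 v.2 t hS

end Restrict

/-! ### Coordinate projections -/

section Standard

variable {n r : ℕ} {a : Fin (r + 2) → ℕ}

theorem coordProj_apply (A : Finset (Fin n)) (v : Fin n → ℂ) (t : Fin n) :
    (coordProj A v : Fin n → ℂ) t = if t ∈ A then v t else 0 := by
  simp [coordProj, LinearMap.codRestrict_apply, LinearMap.sum_apply, Finset.sum_apply,
    Pi.single_apply]

theorem isCoord_coordSpan (A : Finset (Fin n)) :
    IsCoord (Pi.basisFun ℂ (Fin n)) (coordSpan A) A := by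
  have h := isCoord_span (Pi.basisFun ℂ (Fin n)) A
  have h2 : coordSpan A = Submodule.span ℂ ((Pi.basisFun ℂ (Fin n)) '' (A : Set (Fin n))) := by
    rw [coordSpan]
    congr 1
    ext v
    simp
  rwa [← h2] at h

theorem mem_coordSpan {A : Finset (Fin n)} {v : Fin n → ℂ} :
    v ∈ coordSpan A ↔ ∀ t, t ∉ A → v t = 0 := by
  simpa using isCoord_coordSpan A v

theorem coordSpan_mono {A B : Finset (Fin n)} (h : A ⊆ B) : coordSpan A ≤ coordSpan B := by
  intro v hv
  rw [mem_coordSpan] at hv ⊢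
  exact fun t ht => hv t fun h' => ht (h h')

theorem coordProj_of_mem {A : Finset (Fin n)} {v : Fin n → ℂ} (hv : v ∈ coordSpan A) :
    (coordProj A v : Fin n → ℂ) = v := by
  ext t
  rw [coordProj_apply]
  split_ifs with h
  · rfl
  · exact (mem_coordSpan.1 hv t h).symm

theorem coordProj_coe {A : Finset (Fin n)} (v : coordSpan A) : coordProj A (v : Fin n → ℂ) = v :=
  Subtype.ext (coordProj_of_mem v.2)

theorem coordProj_eq_zero {A B : Finset (Fin n)} (h : Disjoint A B) {v : Fin n → ℂ}
    (hv : v ∈ coordSpan B) : coordProj A v = 0 := by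
  ext t
  rw [coordProj_apply]
  split_ifs with ht
  · exact mem_coordSpan.1 hv t (Finset.disjoint_left.1 h ht)
  · rfl

theorem sum_coordProj_block (ha : StrictMono a) (ha0 : a 0 = 0)
    (han : a (Fin.last (r + 1)) = n) (v : Fin n → ℂ) :
    ∑ i, (coordProj (block n a i) v : Fin n → ℂ) = v := by
  ext t
  obtain ⟨i, hi⟩ := exists_mem_block ha0 han t
  rw [Finset.sum_apply, Finset.sum_eq_single i]
  · rw [coordProj_apply, if_pos hi]
  · intro j _ hji
    rw [coordProj_apply, if_neg fun hj => Finset.disjoint_left.1 (disjoint_block ha hji) hj hi]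
  · simp

/-! ### Bases compatible with the blocks -/

/-- For a union of blocks `S`, the vectors `f t` with `t ∈ S` lie in `coordSpan S`, and their number
is its dimension. -/
theorem IsCoord.of_block_basis (ha0 : a 0 = 0) (han : a (Fin.last (r + 1)) = n)
    {f : Basis (Fin n) ℂ (Fin n → ℂ)} (hf : ∀ i, ∀ t ∈ block n a i, f t ∈ Q n a i)
    {S : Finset (Fin n)} (hS : ∀ i, ∀ s ∈ block n a i, s ∈ S → block n a i ⊆ S) :
    IsCoord f (coordSpan S) S := by
  have h : Submodule.span ℂ (f '' (S : Set (Fin n))) = coordSpan S := by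
    refine Submodule.eq_of_le_of_finrank_eq (Submodule.span_le.2 ?_) ?_
    · rintro _ ⟨t, ht, rfl⟩
      obtain ⟨i, hi⟩ := exists_mem_block ha0 han t
      exact coordSpan_mono (hS i t hi ht) (hf i t hi)
    · rw [(isCoord_span f S).finrank_eq, (isCoord_coordSpan S).finrank_eq]
  rw [← h]
  exact isCoord_span f S

theorem isCoord_Q (ha : StrictMono a) (ha0 : a 0 = 0) (han : a (Fin.last (r + 1)) = n)
    {f : Basis (Fin n) ℂ (Fin n → ℂ)} (hf : ∀ i, ∀ t ∈ block n a i, f t ∈ Q n a i)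
    (i : Fin (r + 1)) : IsCoord f (Q n a i) (block n a i) := by
  refine IsCoord.of_block_basis ha0 han hf fun j s hj hi => ?_
  rw [show j = i by
    by_contra h
    exact Finset.disjoint_left.1 (disjoint_block ha h) hj hi]

theorem isCoord_stdPartialFlag (ha : StrictMono a) (ha0 : a 0 = 0)
    (han : a (Fin.last (r + 1)) = n)
    {f : Basis (Fin n) ℂ (Fin n → ℂ)} (hf : ∀ i, ∀ t ∈ block n a i, f t ∈ Q n a i)
    (k : Fin r) : IsCoord f (stdPartialFlag n a k)
      (Finset.univ.filter fun t : Fin n => t.val < steps a k) := by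
  refine IsCoord.of_block_basis ha0 han hf fun i s hi hs t ht => ?_
  rw [mem_block] at hi ht
  have hs' : s.val < a k.succ.castSucc := (Finset.mem_filter.1 hs).2
  refine Finset.mem_filter.2 ⟨Finset.mem_univ _, ?_⟩
  have h1 : a i.castSucc < a k.succ.castSucc := by omega
  have h2 : a i.succ ≤ a k.succ.castSucc := by
    rw [ha.lt_iff_lt, Fin.lt_def] at h1
    refine ha.monotone ?_
    rw [Fin.le_def]
    simp at h1 ⊢
    omega
  exact ht.2.trans_le h2

/-- Each `f t` lies in one summand, so the projection fixes it or kills it. This compatibility of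
the flag with the blocks underlies both (i) and (ii). -/
theorem IsCoord.coordProj_mem (ha : StrictMono a) (ha0 : a 0 = 0)
    (han : a (Fin.last (r + 1)) = n)
    {f : Basis (Fin n) ℂ (Fin n → ℂ)} (hf : ∀ i, ∀ t ∈ block n a i, f t ∈ Q n a i)
    {U : Submodule ℂ (Fin n → ℂ)} {S : Finset (Fin n)} (hU : IsCoord f U S) (i : Fin (r + 1))
    {v : Fin n → ℂ} (hv : v ∈ U) : (coordProj (block n a i) v : Fin n → ℂ) ∈ U := by
  have h : U ≤ U.comap ((Q n a i).subtype ∘ₗ coordProj (block n a i)) := by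
    conv_lhs => rw [hU.eq_span]
    rw [Submodule.span_le]
    rintro _ ⟨t, ht, rfl⟩
    show (coordProj (block n a i) (f t) : Fin n → ℂ) ∈ U
    obtain ⟨j, hj⟩ := exists_mem_block ha0 han t
    by_cases hij : i = j
    · subst hij
      rw [coordProj_of_mem (hf i t hj)]
      exact (hU.mem_basis t).2 ht
    · rw [coordProj_eq_zero (disjoint_block ha hij) (hf j t hj)]
      exact U.zero_mem
  exact h hv

/-- Take `f t = l e_t`, which stays in the block of `t` because `l` is block diagonal. The
`j`-dimensional member is spanned by the `l e_{w⁻¹ k}` with `k < j`, that is, by the `f t` with `w t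
< j`. -/
theorem exists_basis_of_mem_leviFlags (ha : StrictMono a) {w : Equiv.Perm (Fin n)}
    {F : Flag (Submodule ℂ (Fin n → ℂ))} (hF : F ∈ leviFlags a w) :
    ∃ f : Basis (Fin n) ℂ (Fin n → ℂ), (∀ i, ∀ t ∈ block n a i, f t ∈ Q n a i) ∧
      ∀ U ∈ F, ∃ j ≤ n, IsCoord f U (Finset.univ.filter fun t => (w t).val < j) := by
  obtain ⟨l, hl, rfl⟩ := hF
  refine ⟨(Pi.basisFun ℂ (Fin n)).map (Matrix.SpecialLinearGroup.toLin' l), ?_, ?_⟩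
  · intro i t ht
    rw [mem_coordSpan]
    intro s hs
    have h1 : ((Pi.basisFun ℂ (Fin n)).map (Matrix.SpecialLinearGroup.toLin' l)) t s = l.1 s t := by
      simp [Matrix.SpecialLinearGroup.toLin'_apply]
    rw [h1]
    apply hl
    rintro ⟨j, hsj, htj⟩
    by_cases hij : i = j
    · exact hs (hij ▸ hsj)
    · exact Finset.disjoint_left.1 (disjoint_block ha hij) ht htj
  · rintro U hU
    obtain ⟨_, ⟨U, hU, rfl⟩, rfl⟩ := hU
    obtain ⟨j, rfl⟩ := (Basis.mem_toFlag _).1 hU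
    refine ⟨j.val, by omega, ?_⟩
    convert isCoord_span _ _ using 1
    show Submodule.map _ (Submodule.map _ _) = _
    rw [Basis.flag, Submodule.map_span, Submodule.map_span]
    congr 1
    ext v
    simp only [Set.mem_image, exists_exists_and_eq_and]
    constructor
    · rintro ⟨i, hi, rfl⟩
      refine ⟨w⁻¹ i, by simpa [Fin.lt_def] using hi, ?_⟩
      have := permAct_single w⁻¹ i
      simp at this ⊢
      rw [this]
    · rintro ⟨t, ht, rfl⟩
      refine ⟨w t, by simpa [Fin.lt_def] using ht, ?_⟩
      have := permAct_single w⁻¹ (w t)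
      simp at this ⊢
      rw [this]

end Standard

/-! ### The points of the Schubert cells -/

section Points

variable {n r : ℕ} {a : Fin (r + 2) → ℕ}

theorem steps_le (ha : StrictMono a) (han : a (Fin.last (r + 1)) = n) (k : Fin r) :
    steps a k ≤ n :=
  han ▸ ha.monotone (Fin.le_last _)

theorem stdPartialFlag_mem_flagVariety (ha : StrictMono a) (han : a (Fin.last (r + 1)) = n) :
    stdPartialFlag n a ∈ flagVariety (Fin n → ℂ) (steps a) := by
  refine ⟨fun k l hkl => coordSpan_mono fun t ht => ?_, fun k => ?_⟩
  · have h : steps a k ≤ steps a l := ha.monotone (by rw [Fin.le_def] at hkl ⊢; simpa using hkl)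
    simp only [Finset.mem_filter, Finset.mem_univ, true_and] at ht ⊢
    omega
  · rw [stdPartialFlag, (isCoord_coordSpan _).finrank_eq, Fin.card_filter_val_lt,
      min_eq_right (steps_le ha han k)]

theorem stdPartialFlag_mem_schubertCell (ha : StrictMono a) (ha0 : a 0 = 0)
    (han : a (Fin.last (r + 1)) = n) {w : Equiv.Perm (Fin n)}
    {F : Flag (Submodule ℂ (Fin n → ℂ))}
    {f : Basis (Fin n) ℂ (Fin n → ℂ)} (hf : ∀ i, ∀ t ∈ block n a i, f t ∈ Q n a i)
    (hF : ∀ U ∈ F, ∃ j ≤ n, IsCoord f U (Finset.univ.filter fun t => (w t).val < j)) :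
    stdPartialFlag n a ∈ schubertCell (steps a) w F := by
  refine ⟨stdPartialFlag_mem_flagVariety ha han, fun k U hU => ?_⟩
  obtain ⟨j, hj, hUj⟩ := hF U hU
  rw [((isCoord_stdPartialFlag ha ha0 han hf k).inf hUj).finrank_eq, hUj.finrank_eq,
    card_filter_perm_lt w hj, ← Finset.filter_and]

theorem finrank_comap_subtype_of_le {E : Type*} [AddCommGroup E] [Module ℂ E]
    {P W : Submodule ℂ E} (h : P ≤ W) : finrank ℂ (P.comap W.subtype) = finrank ℂ P :=
  (Submodule.comapSubtypeEquivOfLe h).finrank_eq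

theorem grPoint_mem_flagVariety (ha : StrictMono a) (han : a (Fin.last (r + 1)) = n)
    (i j : Fin (r + 1)) : grPoint (Q n a i) (Q n a j) ∈
      flagVariety ↥(Q n a i ⊔ Q n a j) (fun _ : Unit => blockSize a i) := by
  refine ⟨fun _ _ _ => le_rfl, fun k => ?_⟩
  rw [grPoint, finrank_comap_subtype_of_le le_sup_left, (isCoord_coordSpan _).finrank_eq,
    card_block ha han]

theorem grPoint_mem_schubertCell (ha : StrictMono a) (ha0 : a 0 = 0)
    (han : a (Fin.last (r + 1)) = n) {w : Equiv.Perm (Fin n)}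
    {F : Flag (Submodule ℂ (Fin n → ℂ))}
    {f : Basis (Fin n) ℂ (Fin n → ℂ)} (hf : ∀ i, ∀ t ∈ block n a i, f t ∈ Q n a i)
    (hF : ∀ U ∈ F, ∃ j ≤ n, IsCoord f U (Finset.univ.filter fun t => (w t).val < j))
    {i j : Fin (r + 1)} (hij : i < j) :
    grPoint (Q n a i) (Q n a j) ∈
      schubertCell (fun _ : Unit => blockSize a i) (flatten w (block n a i ∪ block n a j))
        (inducedFlag F (Q n a i ⊔ Q n a j)) := by
  refine ⟨grPoint_mem_flagVariety ha han i j, ?_⟩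
  rintro k _ ⟨U, hU, rfl⟩
  obtain ⟨m, hm, hUm⟩ := hF U hU
  have hi := isCoord_Q ha ha0 han hf i
  have hj := isCoord_Q ha ha0 han hf j
  have h1 : finrank ℂ (U.comap (Q n a i ⊔ Q n a j).subtype) =
      ((block n a i ∪ block n a j).filter fun t => (w t).val < m).card := by
    rw [show U.comap (Q n a i ⊔ Q n a j).subtype = ((Q n a i ⊔ Q n a j) ⊓ U).comap
      (Q n a i ⊔ Q n a j).subtype by simp, finrank_comap_subtype_of_le inf_le_left,
      ((hi.sup hj).inf hUm).finrank_eq, ← Finset.filter_mem_eq_inter]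
    congr 1
    ext t
    simp
  have h2 : finrank ℂ (grPoint (Q n a i) (Q n a j) k ⊓ U.comap (Q n a i ⊔ Q n a j).subtype :
      Submodule ℂ _) = ((block n a i).filter fun t => (w t).val < m).card := by
    rw [grPoint, ← Submodule.comap_inf, finrank_comap_subtype_of_le (inf_le_left.trans le_sup_left),
      (hi.inf hUm).finrank_eq]
    congr 1
    ext t
    simp
  rw [h1, h2, ← card_block ha han]
  exact (card_filter_flatten w Finset.subset_union_left (block_isLowerSet ha hij) m).symm

end Points

/-! ### The block decomposition of the tangent space -/

section Blocks

variable {n r : ℕ} {a : Fin (r + 2) → ℕ}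

theorem Q_le_stdPartialFlag (ha : StrictMono a) {i : Fin (r + 1)} {k : Fin r}
    (h : i.val ≤ k.val) : Q n a i ≤ stdPartialFlag n a k := by
  refine coordSpan_mono fun t ht => ?_
  have h1 : a i.succ ≤ a k.succ.castSucc := ha.monotone (by rw [Fin.le_def]; simpa using h)
  rw [mem_block] at ht
  exact Finset.mem_filter.2 ⟨Finset.mem_univ _, ht.2.trans_le h1⟩

theorem coordProj_eq_zero_of_mem_stdPartialFlag (ha : StrictMono a) {i : Fin (r + 1)} {k : Fin r}
    (h : k.val < i.val) {v : Fin n → ℂ} (hv : v ∈ stdPartialFlag n a k) :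
    coordProj (block n a i) v = 0 := by
  refine coordProj_eq_zero ?_ hv
  rw [Finset.disjoint_left]
  intro t ht ht'
  have h1 : a k.succ.castSucc ≤ a i.castSucc := ha.monotone (by rw [Fin.le_def]; simpa using h)
  rw [mem_block] at ht
  have h2 : t.val < a k.succ.castSucc := (Finset.mem_filter.1 ht').2
  exact absurd h2 (not_lt.2 (h1.trans ht.1))

/-- The extension by zero of `ψ : Q_i → Q_j` to an endomorphism of `ℂⁿ`. -/
def blockExtend (n : ℕ) (a : Fin (r + 2) → ℕ) (i j : Fin (r + 1)) (ψ : Q n a i →ₗ[ℂ] Q n a j) :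
    Module.End ℂ (Fin n → ℂ) :=
  (Q n a j).subtype ∘ₗ ψ ∘ₗ coordProj (block n a i)

theorem homToTangent_eq (i j : Fin (r + 1)) (ψ : Q n a i →ₗ[ℂ] Q n a j) :
    homToTangent n a i j ψ = orbitDifferential (stdPartialFlag n a) (blockExtend n a i j ψ) := rfl

theorem blockExtend_apply (i j : Fin (r + 1)) (ψ : Q n a i →ₗ[ℂ] Q n a j) (v : Fin n → ℂ) :
    blockExtend n a i j ψ v = ψ (coordProj (block n a i) v) := rfl

/-- The block `Q_i → Q_j` of an endomorphism of `ℂⁿ`. -/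
def blockComponent (n : ℕ) (a : Fin (r + 2) → ℕ) (i j : Fin (r + 1)) :
    Module.End ℂ (Fin n → ℂ) →ₗ[ℂ] (Q n a i →ₗ[ℂ] Q n a j) :=
  LinearMap.lcomp ℂ _ (Q n a i).subtype ∘ₗ LinearMap.compRight ℂ (coordProj (block n a j))

theorem blockComponent_apply (i j : Fin (r + 1)) (x : Module.End ℂ (Fin n → ℂ)) (v : Q n a i) :
    blockComponent n a i j x v = coordProj (block n a j) (x v) := rfl

theorem blockComponent_blockExtend (i j : Fin (r + 1)) (ψ : Q n a i →ₗ[ℂ] Q n a j) :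
    blockComponent n a i j (blockExtend n a i j ψ) = ψ := by
  ext1 v
  rw [blockComponent_apply, blockExtend_apply, coordProj_coe, coordProj_coe]

theorem blockComponent_blockExtend_of_ne (ha : StrictMono a) {i j i' j' : Fin (r + 1)}
    (h : (i, j) ≠ (i', j')) (ψ : Q n a i →ₗ[ℂ] Q n a j) :
    blockComponent n a i' j' (blockExtend n a i j ψ) = 0 := by
  ext1 v
  rw [blockComponent_apply, blockExtend_apply, LinearMap.zero_apply]
  by_cases hi : i = i'
  · have hj : j' ≠ j := fun hj => h (by rw [hi, hj])
    exact coordProj_eq_zero (disjoint_block ha hj) (ψ _).2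
  · rw [coordProj_eq_zero (disjoint_block ha hi) v.2]
    simp

/-- Counting from `0`, the step with index `i` is `Q_0 ⊕ ... ⊕ Q_i`. It contains `Q_i` and projects
to zero in `Q_j`, so an endomorphism preserving it has no block `Q_i → Q_j`. -/
theorem ker_orbitDifferential_le_ker_blockComponent (ha : StrictMono a) {i j : Fin (r + 1)}
    (hij : i < j) : LinearMap.ker (orbitDifferential (stdPartialFlag n a)) ≤
      LinearMap.ker (blockComponent n a i j) := by
  intro x hx
  rw [LinearMap.mem_ker, orbitDifferential_eq_zero_iff] at hx
  rw [LinearMap.mem_ker]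
  ext1 v
  have hir : i.val < r := by rw [Fin.lt_def] at hij; omega
  exact coordProj_eq_zero_of_mem_stdPartialFlag (k := ⟨i.val, hir⟩) ha hij
    (hx _ _ (Q_le_stdPartialFlag ha le_rfl v.2))

theorem homToTangent_injective (ha : StrictMono a) {i j : Fin (r + 1)} (hij : i < j) :
    Function.Injective (homToTangent n a i j) := by
  intro ψ φ hψ
  rw [homToTangent_eq, homToTangent_eq, orbitDifferential_eq_iff] at hψ
  have h := ker_orbitDifferential_le_ker_blockComponent ha hij
    (LinearMap.mem_ker.2 (orbitDifferential_eq_zero_iff.2 hψ))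
  rwa [LinearMap.mem_ker, map_sub, blockComponent_blockExtend, blockComponent_blockExtend,
    sub_eq_zero] at h

/-- The other summands come from endomorphisms with zero block at `p`, and this block is well
defined on tangent vectors. -/
theorem iSupIndep_homSummand (ha : StrictMono a) :
    iSupIndep (fun p : {p : Fin (r + 1) × Fin (r + 1) // p.1 < p.2} =>
      homSummand n a p.1.1 p.1.2) := by
  intro p
  rw [Submodule.disjoint_def]
  rintro _ ⟨ψ, rfl⟩ hψ
  have hle : (⨆ q, ⨆ (_ : q ≠ p), homSummand n a q.1.1 q.1.2) ≤
      (LinearMap.ker (blockComponent n a p.1.1 p.1.2)).map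
        (orbitDifferential (stdPartialFlag n a)) := by
    refine iSup₂_le fun q hq => ?_
    rintro _ ⟨φ, rfl⟩
    refine Submodule.mem_map_of_mem (LinearMap.mem_ker.2 ?_)
    exact blockComponent_blockExtend_of_ne ha (fun h => hq (Subtype.ext h)) φ
  have h := hle hψ
  rw [homToTangent_eq,
    orbitDifferential_mem_map_iff (ker_orbitDifferential_le_ker_blockComponent ha p.2),
    LinearMap.mem_ker, blockComponent_blockExtend] at h
  rw [h, map_zero]

theorem orbitDifferential_blockExtend_eq_zero (ha : StrictMono a) {i j : Fin (r + 1)}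
    (hji : j ≤ i) (ψ : Q n a i →ₗ[ℂ] Q n a j) :
    orbitDifferential (stdPartialFlag n a) (blockExtend n a i j ψ) = 0 := by
  rw [orbitDifferential_eq_zero_iff]
  intro k v hv
  rw [blockExtend_apply]
  by_cases h : j.val ≤ k.val
  · exact Q_le_stdPartialFlag ha h (ψ _).2
  · rw [coordProj_eq_zero_of_mem_stdPartialFlag ha (by rw [Fin.le_def] at hji; omega) hv]
    simp

theorem sum_blockExtend_blockComponent (ha : StrictMono a) (ha0 : a 0 = 0)
    (han : a (Fin.last (r + 1)) = n) (x : Module.End ℂ (Fin n → ℂ)) :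
    ∑ i, ∑ j, blockExtend n a i j (blockComponent n a i j x) = x := by
  refine LinearMap.ext fun v => ?_
  simp only [LinearMap.sum_apply, blockExtend_apply, blockComponent_apply,
    sum_coordProj_block ha ha0 han]
  rw [← map_sum, sum_coordProj_block ha ha0 han]

/-- An element of `C` is the sum of its blocks; those with `j ≤ i` preserve the standard flag and
drop out. The case `C = ⊤` decomposes the whole tangent space, and `C = rankTangent` gives (i). -/
theorem iSup_homSummand_inf_map (ha : StrictMono a) (ha0 : a 0 = 0)
    (han : a (Fin.last (r + 1)) = n) {C : Submodule ℂ (Module.End ℂ (Fin n → ℂ))}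
    (hC : ∀ x ∈ C, ∀ i j, blockExtend n a i j (blockComponent n a i j x) ∈ C) :
    (⨆ p : {p : Fin (r + 1) × Fin (r + 1) // p.1 < p.2}, homSummand n a p.1.1 p.1.2 ⊓
      C.map (orbitDifferential (stdPartialFlag n a))) =
      C.map (orbitDifferential (stdPartialFlag n a)) := by
  refine le_antisymm (iSup_le fun p => inf_le_right) ?_
  rintro _ ⟨x, hx, rfl⟩
  rw [← sum_blockExtend_blockComponent ha ha0 han x, map_sum]
  refine Submodule.sum_mem _ fun i _ => ?_
  rw [map_sum]
  refine Submodule.sum_mem _ fun j _ => ?_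
  by_cases hij : i < j
  · exact Submodule.mem_iSup_of_mem ⟨(i, j), hij⟩
      ⟨⟨_, homToTangent_eq i j _⟩, Submodule.mem_map_of_mem (hC x hx i j)⟩
  · rw [orbitDifferential_blockExtend_eq_zero ha (not_lt.1 hij)]
    exact Submodule.zero_mem _

theorem blockExtend_blockComponent_mem_rankTangent (ha : StrictMono a) (ha0 : a 0 = 0)
    (han : a (Fin.last (r + 1)) = n) {F : Flag (Submodule ℂ (Fin n → ℂ))}
    {f : Basis (Fin n) ℂ (Fin n → ℂ)} (hf : ∀ i, ∀ t ∈ block n a i, f t ∈ Q n a i)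
    (hF : ∀ U ∈ F, ∃ S, IsCoord f U S) {x : Module.End ℂ (Fin n → ℂ)}
    (hx : x ∈ rankTangent F (stdPartialFlag n a)) (i j : Fin (r + 1)) :
    blockExtend n a i j (blockComponent n a i j x) ∈ rankTangent F (stdPartialFlag n a) := by
  rw [mem_rankTangent] at hx ⊢
  intro k U hU v hv hvU
  obtain ⟨S, hS⟩ := hF U hU
  have hk := isCoord_stdPartialFlag ha ha0 han hf k
  exact (hk.sup hS).coordProj_mem ha ha0 han hf j
    (hx k U hU _ (hk.coordProj_mem ha ha0 han hf i hv) (hS.coordProj_mem ha ha0 han hf i hvU))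

/-- Only the step with index `i` matters for necessity: it contains `Q_i`, and projecting `V_i + U`
to `Q_j` kills `V_i` and keeps `U` inside itself. -/
theorem blockExtend_mem_rankTangent_iff (ha : StrictMono a) (ha0 : a 0 = 0)
    (han : a (Fin.last (r + 1)) = n) {F : Flag (Submodule ℂ (Fin n → ℂ))}
    {f : Basis (Fin n) ℂ (Fin n → ℂ)} (hf : ∀ i, ∀ t ∈ block n a i, f t ∈ Q n a i)
    (hF : ∀ U ∈ F, ∃ S, IsCoord f U S) {i j : Fin (r + 1)} (hij : i < j)
    (ψ : Q n a i →ₗ[ℂ] Q n a j) :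
    blockExtend n a i j ψ ∈ rankTangent F (stdPartialFlag n a) ↔
      ∀ U ∈ F, ∀ v : Q n a i, (v : Fin n → ℂ) ∈ U → (ψ v : Fin n → ℂ) ∈ U := by
  rw [mem_rankTangent]
  constructor
  · intro h U hU v hv
    obtain ⟨S, hS⟩ := hF U hU
    have hir : i.val < r := by rw [Fin.lt_def] at hij; omega
    have h1 := h ⟨i.val, hir⟩ U hU v (Q_le_stdPartialFlag ha le_rfl v.2) hv
    rw [blockExtend_apply, coordProj_coe] at h1
    obtain ⟨y, hy, z, hz, hyz⟩ := Submodule.mem_sup.1 h1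
    have h2 := coordProj_of_mem (ψ v).2
    rw [← hyz, map_add, coordProj_eq_zero_of_mem_stdPartialFlag ha hij hy, zero_add, hyz] at h2
    rw [← h2]
    exact hS.coordProj_mem ha ha0 han hf j hz
  · intro h k U hU v hv hvU
    obtain ⟨S, hS⟩ := hF U hU
    exact Submodule.mem_sup_right (h U hU _ (hS.coordProj_mem ha ha0 han hf i hvU))

end Blocks

/-! ### The tangent space of the Grassmannian -/

section Grassmannian

variable {n r : ℕ} {a : Fin (r + 2) → ℕ}

/-- The extension by zero of `ψ : Q_i → Q_j` to an endomorphism of `Q_i ⊕ Q_j`. -/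
def grExtend (n : ℕ) (a : Fin (r + 2) → ℕ) (i j : Fin (r + 1)) (ψ : Q n a i →ₗ[ℂ] Q n a j) :
    Module.End ℂ ↥(Q n a i ⊔ Q n a j) :=
  Submodule.inclusion le_sup_right ∘ₗ ψ ∘ₗ coordProj (block n a i) ∘ₗ (Q n a i ⊔ Q n a j).subtype

theorem coe_grExtend_apply (i j : Fin (r + 1)) (ψ : Q n a i →ₗ[ℂ] Q n a j)
    (v : ↥(Q n a i ⊔ Q n a j)) :
    (grExtend n a i j ψ v : Fin n → ℂ) = ψ (coordProj (block n a i) v) := rfl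

theorem homToGrTangent_eq (i j : Fin (r + 1)) (ψ : Q n a i →ₗ[ℂ] Q n a j) :
    homToGrTangent (Q n a i) (Q n a j) ψ =
      orbitDifferential (grPoint (Q n a i) (Q n a j)) (grExtend n a i j ψ) := by
  funext k
  ext1 v
  have h : coordProj (block n a i) ((v : ↥(Q n a i ⊔ Q n a j)) : Fin n → ℂ) =
      grPointEquiv (Q n a i) (Q n a j) k v :=
    coordProj_coe (grPointEquiv (Q n a i) (Q n a j) k v)
  show (grPoint (Q n a i) (Q n a j) k).mkQ _ = (grPoint (Q n a i) (Q n a j) k).mkQ _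
  congr 1
  refine Subtype.ext ?_
  show ((ψ _ : Q n a j) : Fin n → ℂ) = (ψ (coordProj _ _) : Q n a j)
  congr 2
  exact h.symm

theorem homToGrTangent_injective (ha : StrictMono a) {i j : Fin (r + 1)} (hij : i ≠ j) :
    Function.Injective (homToGrTangent (Q n a i) (Q n a j)) := by
  intro ψ φ hψ
  rw [homToGrTangent_eq, homToGrTangent_eq, orbitDifferential_eq_iff] at hψ
  ext1 v
  have h : (grExtend n a i j ψ ⟨v, Submodule.mem_sup_left v.2⟩ -
      grExtend n a i j φ ⟨v, Submodule.mem_sup_left v.2⟩ : Fin n → ℂ) ∈ Q n a i :=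
    hψ () ⟨v, Submodule.mem_sup_left v.2⟩ v.2
  rw [coe_grExtend_apply, coe_grExtend_apply, coordProj_coe] at h
  rw [← sub_eq_zero, ← coordProj_coe (ψ v - φ v)]
  exact coordProj_eq_zero (disjoint_block ha hij.symm) h

/-- An endomorphism `x` is represented by its block `Q_i → Q_j`, since on `Q_i` the two differ by a
`Q_i`-valued map. -/
theorem range_homToGrTangent (ha : StrictMono a) {i j : Fin (r + 1)} (hij : i ≠ j) :
    LinearMap.range (homToGrTangent (Q n a i) (Q n a j)) =
      LinearMap.range (orbitDifferential (grPoint (Q n a i) (Q n a j))) := by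
  apply le_antisymm
  · rintro _ ⟨ψ, rfl⟩
    exact ⟨_, (homToGrTangent_eq i j ψ).symm⟩
  · rintro _ ⟨x, rfl⟩
    refine ⟨coordProj (block n a j) ∘ₗ (Q n a i ⊔ Q n a j).subtype ∘ₗ x ∘ₗ
      Submodule.inclusion le_sup_left, ?_⟩
    rw [homToGrTangent_eq, orbitDifferential_eq_iff]
    intro k v hv
    obtain ⟨y, hy, z, hz, hyz⟩ := Submodule.mem_sup.1 (x v).2
    have hv' : Submodule.inclusion le_sup_left (coordProj (block n a i) (v : Fin n → ℂ)) = v :=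
      Subtype.ext (coordProj_of_mem (show (v : Fin n → ℂ) ∈ Q n a i from hv))
    show (grExtend n a i j _ v - x v : Fin n → ℂ) ∈ Q n a i
    rw [coe_grExtend_apply]
    simp only [LinearMap.comp_apply, hv', Submodule.subtype_apply]
    rw [← hyz, map_add, coordProj_eq_zero (disjoint_block ha hij.symm) hy, zero_add,
      coordProj_of_mem hz]
    simpa using hy

/-- The right side is the same as in `blockExtend_mem_rankTangent_iff`; this coincidence is the
content of (ii). -/
theorem grExtend_mem_rankTangent_iff (ha : StrictMono a) (ha0 : a 0 = 0)
    (han : a (Fin.last (r + 1)) = n) {F : Flag (Submodule ℂ (Fin n → ℂ))}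
    {f : Basis (Fin n) ℂ (Fin n → ℂ)} (hf : ∀ i, ∀ t ∈ block n a i, f t ∈ Q n a i)
    (hF : ∀ U ∈ F, ∃ S, IsCoord f U S) {i j : Fin (r + 1)} (hij : i ≠ j)
    (ψ : Q n a i →ₗ[ℂ] Q n a j) :
    grExtend n a i j ψ ∈
        rankTangent (inducedFlag F (Q n a i ⊔ Q n a j)) (grPoint (Q n a i) (Q n a j)) ↔
      ∀ U ∈ F, ∀ v : Q n a i, (v : Fin n → ℂ) ∈ U → (ψ v : Fin n → ℂ) ∈ U := by
  rw [mem_rankTangent]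
  constructor
  · intro h U hU v hv
    obtain ⟨S, hS⟩ := hF U hU
    have h1 := h () _ ⟨U, hU, rfl⟩ ⟨v, Submodule.mem_sup_left v.2⟩ v.2 hv
    obtain ⟨y, hy, z, hz, hyz⟩ := Submodule.mem_sup.1 h1
    have hyz' : (y : Fin n → ℂ) + z = ψ v := by
      have := congrArg Subtype.val hyz
      rwa [coe_grExtend_apply, coordProj_coe] at this
    have hy' : coordProj (block n a j) (y : Fin n → ℂ) = 0 :=
      coordProj_eq_zero (disjoint_block ha hij.symm) hy
    have h2 := coordProj_of_mem (ψ v).2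
    rw [← hyz', map_add, hy', zero_add, hyz'] at h2
    rw [← h2]
    exact hS.coordProj_mem ha ha0 han hf j hz
  · rintro h k _ ⟨U, hU, rfl⟩ v hv hvU
    obtain ⟨S, hS⟩ := hF U hU
    exact Submodule.mem_sup_right (h U hU _ (hS.coordProj_mem ha ha0 han hf i hvU))

theorem tangentSpace_grPoint (ha : StrictMono a) (ha0 : a 0 = 0)
    (han : a (Fin.last (r + 1)) = n) {w : Equiv.Perm (Fin n)}
    {F : Flag (Submodule ℂ (Fin n → ℂ))}
    {f : Basis (Fin n) ℂ (Fin n → ℂ)} (hf : ∀ i, ∀ t ∈ block n a i, f t ∈ Q n a i)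
    (hF : ∀ U ∈ F, ∃ j ≤ n, IsCoord f U (Finset.univ.filter fun t => (w t).val < j))
    {i j : Fin (r + 1)} (hij : i < j) :
    tangentSpace (schubertCell (fun _ : Unit => blockSize a i)
        (flatten w (block n a i ∪ block n a j)) (inducedFlag F (Q n a i ⊔ Q n a j)))
        (grPoint (Q n a i) (Q n a j)) =
      (rankTangent (inducedFlag F (Q n a i ⊔ Q n a j)) (grPoint (Q n a i) (Q n a j))).map
        (orbitDifferential (grPoint (Q n a i) (Q n a j))) := by
  have hi := isCoord_Q ha ha0 han hf i
  have hW := hi.sup (isCoord_Q ha ha0 han hf j)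
  obtain ⟨g, hg⟩ := hW.exists_basis
  refine tangentSpace_schubertCell (grPoint_mem_schubertCell ha ha0 han hf hF hij) g
    (fun k => ⟨_, hW.comap_subtype hg hi⟩) ?_
  rintro _ ⟨U, hU, rfl⟩
  obtain ⟨m, -, hm⟩ := hF U hU
  exact ⟨_, hW.comap_subtype hg hm⟩

end Grassmannian

end SchubertTangent

end

/-! ### The proposition. -/

open SchubertTangent in
theorem mainTheorem6 (n r : ℕ) (a : Fin (r + 2) → ℕ) (ha : StrictMono a)
    (ha0 : a 0 = 0) (han : a (Fin.last (r + 1)) = n)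
    (w : Equiv.Perm (Fin n)) (hw : IsMinimalRep (steps a) w)
    (F : Flag (Submodule ℂ (Fin n → ℂ))) (hF : F ∈ leviFlags a w) :
    -- the identification of the tangent space at the standard flag with `⨁_{i<j} Hom(Q_i, Q_j)`
    ((∀ i j, i < j → Function.Injective (homToTangent n a i j)) ∧
      iSupIndep (fun p : {p : Fin (r + 1) × Fin (r + 1) // p.1 < p.2} =>
        homSummand n a p.1.1 p.1.2) ∧
      (⨆ p : {p : Fin (r + 1) × Fin (r + 1) // p.1 < p.2}, homSummand n a p.1.1 p.1.2) =
        tangentSpace (flagVariety (Fin n → ℂ) (steps a)) (stdPartialFlag n a)) ∧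
    -- the identification of `T_{Q_i} Gr(b_i, Q_i ⊕ Q_j)` with `Hom(Q_i, Q_j)`
    (∀ i j, i < j → Function.Injective (homToGrTangent (Q n a i) (Q n a j)) ∧
      LinearMap.range (homToGrTangent (Q n a i) (Q n a j)) =
        tangentSpace (flagVariety ↥(Q n a i ⊔ Q n a j) (fun _ : Unit => blockSize a i))
          (grPoint (Q n a i) (Q n a j))) ∧
    -- `w_{i,j}` belongs to `S_{b_i + b_j}(b_i)`
    (∀ i j, i < j → (block n a i ∪ block n a j).card = blockSize a i + blockSize a j ∧
      IsMinimalRep (fun _ : Unit => blockSize a i) (flatten w (block n a i ∪ block n a j))) ∧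
    -- the points at which the tangent spaces are taken lie in the cells
    (stdPartialFlag n a ∈ schubertCell (steps a) w F ∧
      ∀ i j, i < j → grPoint (Q n a i) (Q n a j) ∈
        schubertCell (fun _ : Unit => blockSize a i) (flatten w (block n a i ∪ block n a j))
          (inducedFlag F (Q n a i ⊔ Q n a j))) ∧
    -- (i)
    (iSupIndep (fun p : {p : Fin (r + 1) × Fin (r + 1) // p.1 < p.2} =>
        homSummand n a p.1.1 p.1.2 ⊓
          tangentSpace (schubertCell (steps a) w F) (stdPartialFlag n a)) ∧
      (⨆ p : {p : Fin (r + 1) × Fin (r + 1) // p.1 < p.2},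
        homSummand n a p.1.1 p.1.2 ⊓
          tangentSpace (schubertCell (steps a) w F) (stdPartialFlag n a)) =
        tangentSpace (schubertCell (steps a) w F) (stdPartialFlag n a)) ∧
    -- (ii)
    (∀ i j, i < j →
      homSummand n a i j ⊓ tangentSpace (schubertCell (steps a) w F) (stdPartialFlag n a) =
        ((tangentSpace
          (schubertCell (fun _ : Unit => blockSize a i) (flatten w (block n a i ∪ block n a j))
            (inducedFlag F (Q n a i ⊔ Q n a j)))
          (grPoint (Q n a i) (Q n a j))).comap
            (homToGrTangent (Q n a i) (Q n a j))).map (homToTangent n a i j)) := by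
  obtain ⟨f, hf, hFf⟩ := exists_basis_of_mem_leviFlags ha hF
  have hFc : ∀ U ∈ F, ∃ S, IsCoord f U S := fun U hU =>
    let ⟨_, _, h⟩ := hFf U hU
    ⟨_, h⟩
  have hcell := stdPartialFlag_mem_schubertCell ha ha0 han hf hFf
  have hT := tangentSpace_schubertCell hcell f
    (fun k => ⟨_, isCoord_stdPartialFlag ha ha0 han hf k⟩) hFc
  refine ⟨⟨fun i j hij => homToTangent_injective ha hij, iSupIndep_homSummand ha, ?_⟩,
    fun i j hij => ⟨homToGrTangent_injective ha hij.ne, ?_⟩,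
    fun i j hij => ⟨card_block_union ha han hij.ne, hw.flatten ha han hij⟩,
    ⟨hcell, fun i j hij => grPoint_mem_schubertCell ha ha0 han hf hFf hij⟩,
    ⟨(iSupIndep_homSummand ha).mono fun p => inf_le_left, ?_⟩, fun i j hij => ?_⟩
  · rw [tangentSpace_flagVariety (stdPartialFlag_mem_flagVariety ha han), ← Submodule.map_top,
      -- With `C = ⊤` the intersections change nothing, because each summand already lies in the
      -- range of `orbitDifferential`.
      ← iSup_homSummand_inf_map ha ha0 han (C := ⊤) (by simp)]
    refine iSup_congr fun p => (inf_eq_left.2 ?_).symm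
    rintro _ ⟨ψ, rfl⟩
    exact Submodule.mem_map_of_mem Submodule.mem_top
  · rw [tangentSpace_flagVariety (grPoint_mem_flagVariety ha han i j),
      range_homToGrTangent ha hij.ne]
  · rw [hT]
    exact iSup_homSummand_inf_map ha ha0 han fun x hx i j =>
      blockExtend_blockComponent_mem_rankTangent ha ha0 han hf hFc hx i j
  · have key : ∀ ψ, homToTangent n a i j ψ ∈
        tangentSpace (schubertCell (steps a) w F) (stdPartialFlag n a) ↔
        homToGrTangent (Q n a i) (Q n a j) ψ ∈ tangentSpace
          (schubertCell (fun _ : Unit => blockSize a i) (flatten w (block n a i ∪ block n a j))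
            (inducedFlag F (Q n a i ⊔ Q n a j))) (grPoint (Q n a i) (Q n a j)) := by
      intro ψ
      rw [hT, tangentSpace_grPoint ha ha0 han hf hFf hij, homToTangent_eq, homToGrTangent_eq,
        orbitDifferential_mem_map_rankTangent, orbitDifferential_mem_map_rankTangent,
        blockExtend_mem_rankTangent_iff ha ha0 han hf hFc hij,
        grExtend_mem_rankTangent_iff ha ha0 han hf hFc hij.ne]
    ext y
    constructor
    · rintro ⟨⟨ψ, rfl⟩, h⟩
      exact ⟨ψ, (key ψ).1 h, rfl⟩
    · rintro ⟨ψ, h, rfl⟩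
      exact ⟨⟨ψ, rfl⟩, (key ψ).2 h⟩
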